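/- Let $\mathbb F$ be an algebraically closed field, $G$ an arbitrary group, and $D=\bigoplus_{g\in G}D_g$ a $G$-graded division algebra over $\mathbb F$ (every nonzero homogeneous element is invertible, $1\neq 0$) which, as an ungraded algebra, is isomorphic to a matrix algebra $M_\ell(\mathbb F)$. Let $T=\{g\in G: D_g\ne 0\}$ be its support. Let $n\ge 1$, $\gamma=(\gamma_1,\dots,\gamma_n)\in G^n$, and let $R=M_n(D)$ have the $G$-grading with $\deg(e_{ij}\otimes d)=\gamma_i(\deg d)\gamma_j^{-1}$ for homogeneous $d\in D$. An *involution* of an algebra $A$ is an additive map $\psi$ with $\psi(ab)=\psi(b)\psi(a)$ and $\psi^2=1$ that is linear over the center of $A$; it is *degree-inverting* if $\psi(A_g)\subseteq A_{g^{-1}}$ for all $g\in G$. Write $\gamma\sim\gamma'$ if, after reordering, $\gamma'_i\in\gamma_iT$ for all $i$. Call $(g_0,\psi_0,m,s,\gamma')$ *admissible for $\gamma$* if $g_0\in G$; $\psi_0$ is an involution of $D$ with $\psi_0(D_t)\subseteq D_{g_0^{-1}t^{-1}g_0}$ for all $t\in G$; $0\le m\le s$ are integers; $\gamma'=(g_1,\dots,g_m,g'_{m+1},\dots,g'_s,g''_{m+1},\dots,g''_s)$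 with entries in $G$ and $g''_j=g'_jg_0$ for $j>m$; $\gamma\sim\gamma'$; $m=0$ if $g_0\notin T$; and $g_0^2=1$ if $s>m$. 1. $R$ admits a degree-inverting involution if and only if there is a tuple $(g_0,\psi_0,m,s,\gamma')$ admissible for $\gamma$. 2. If $(g_0,\psi_0,m,s,\gamma')$ is admissible for $\gamma$ and $g_0\in T$, then $D$ has a degree-inverting involution $\psi_1$ such that $(1,\psi_1,m,s,\gamma'')$ is admissible for $\gamma$, where $\gamma''=(g_1,\dots,g_m,g'_{m+1},\dots,g'_s,g'_{m+1},\dots,g'_s)$. 3. Let $X_u$ $(u\in T)$ be a homogeneous basis of $D$, $X_u\in D_u$. For every degree-inverting involution $\psi$ of $R$ there are a tuple $(g_0,\psi_0,m,s,\gamma')$ admissible for $\gamma$, with $\psi_0$ degree-inverting if $g_0\in T$, and an invertible matrix $P$ over $D$ with $P_{ij}\in D_{\gamma_i^{-1}\gamma'_j}$ (a change of homogeneous basis, turning the grading given by $\gamma$ into the one given by $\gamma'$), such that, in the new coordinates, $$P^{-1}\psi(Y)P=\Phi^{-1}\,\psi_0\big((P^{-1}YP)^t\big)\,\Phi\qquad\text{for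 all }Y\in R,$$ where $\psi_0$ is applied entrywise, and one of the following holds: (i) (orthogonal) $\psi_0(\Phi^t)=\Phi$ and $$\Phi=\begin{pmatrix} I_m\otimes X_{g_0}&&\\ &0&I_{s-m}\otimes X_1\\ &I_{s-m}\otimes X_1&0\end{pmatrix};$$ (ii) (symplectic) $m=0$, $\psi_0(\Phi^t)=-\Phi$ and $$\Phi=\begin{pmatrix}0&I_s\\-I_s&0\end{pmatrix}\otimes X_1 .$$ -/

import Mathlib

section GradedMatrixAlgebras

variable {F G A D ι κ : Type*}

/-- `A = ⨁ A_g` (a vector space decomposition) with `A_g A_h ⊆ A_{gh}`, for an arbitrary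
(multiplicative, possibly non-commutative) group `G`. -/
structure IsGroupGrading [Field F] [Group G] [Ring A] [Algebra F A]
    (𝒜 : G → Submodule F A) : Prop where
  independent : iSupIndep 𝒜
  spanning : iSup 𝒜 = ⊤
  mul_mem : ∀ {g h : G} {a b : A}, a ∈ 𝒜 g → b ∈ 𝒜 h → a * b ∈ 𝒜 (g * h)

/-- A graded division algebra: every nonzero homogeneous element is invertible. -/
structure IsGradedDivisionAlgebra [Field F] [Group G] [Ring D] [Algebra F D]
    (𝒟 : G → Submodule F D) : Prop extends IsGroupGrading 𝒟 where
  one_ne_zero : (1 : D) ≠ 0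
  isUnit_of_mem : ∀ {g : G} {d : D}, d ∈ 𝒟 g → d ≠ 0 → IsUnit d

/-- The support of a grading. -/
def gradedSupport [Field F] [Ring A] [Algebra F A] (𝒜 : G → Submodule F A) : Set G :=
  {g | 𝒜 g ≠ ⊥}

/-- An involution of the first kind: an anti-automorphism of order at most two that is linear over
the center. -/
structure IsInvolution [Ring A] (ψ : A → A) : Prop where
  map_add : ∀ a b, ψ (a + b) = ψ a + ψ b
  map_center_mul : ∀ z ∈ Subring.center A, ∀ a, ψ (z * a) = z * ψ a
  map_mul : ∀ a b, ψ (a * b) = ψ b * ψ a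
  involutive : ∀ a, ψ (ψ a) = a

/-- A degree-inverting involution: `ψ(A_g) ⊆ A_{g⁻¹}`. -/
structure IsDegreeInvertingInvolution [Field F] [Group G] [Ring A] [Algebra F A]
    (𝒜 : G → Submodule F A) (ψ : A → A) : Prop extends IsInvolution ψ where
  map_mem : ∀ {g : G} {a : A}, a ∈ 𝒜 g → ψ a ∈ 𝒜 g⁻¹

/-- An involution with `deg ψ₀(d) = g₀⁻¹ (deg d)⁻¹ g₀` for homogeneous `d`. -/
structure IsTwistedDegreeInvertingInvolution [Field F] [Group G] [Ring A] [Algebra F A]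
    (𝒜 : G → Submodule F A) (g₀ : G) (ψ₀ : A → A) : Prop extends IsInvolution ψ₀ where
  map_mem : ∀ {g : G} {a : A}, a ∈ 𝒜 g → ψ₀ a ∈ 𝒜 (g₀⁻¹ * g⁻¹ * g₀)

/-- The grading of `M_ι(D)` parametrized by `(D, γ)`: `deg (e_ij ⊗ d) = γ_i (deg d) γ_j⁻¹`. -/
def matrixGrading [Field F] [Group G] [Ring D] [Algebra F D]
    (𝒟 : G → Submodule F D) (γ : ι → G) (g : G) : Submodule F (Matrix ι ι D) where
  carrier := {X | ∀ i j, X i j ∈ 𝒟 ((γ i)⁻¹ * g * γ j)}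
  add_mem' hX hY i j := (𝒟 _).add_mem (hX i j) (hY i j)
  zero_mem' _ _ := (𝒟 _).zero_mem
  smul_mem' c _ hX i j := (𝒟 _).smul_mem c (hX i j)

/-- Two families of degrees agree up to reordering and right multiplication of the entries by
elements of the support `T` of `D` (that is, up to the choice of a homogeneous basis). -/
def SameDegrees [Field F] [Group G] [Ring D] [Algebra F D]
    (𝒟 : G → Submodule F D) (γ : ι → G) (γ' : κ → G) : Prop :=
  ∃ e : ι ≃ κ, ∀ i, (γ i)⁻¹ * γ' (e i) ∈ gradedSupport 𝒟

/-- `P` is the matrix of a change of homogeneous basis of a graded right `D`-module, from a basis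
with degrees `γ` to a basis with degrees `γ'`; `Q` is its inverse. -/
structure IsHomogeneousBaseChange [Field F] [Group G] [Ring D] [Algebra F D]
    [Fintype ι] [DecidableEq ι] [Fintype κ] [DecidableEq κ]
    (𝒟 : G → Submodule F D) (γ : ι → G) (γ' : κ → G)
    (P : Matrix ι κ D) (Q : Matrix κ ι D) : Prop where
  mem : ∀ i j, P i j ∈ 𝒟 ((γ i)⁻¹ * γ' j)
  mul_inv : P * Q = 1
  inv_mul : Q * P = 1

/-- The sequence `(g_1,…,g_m, g'_{m+1},…,g'_s, g''_{m+1},…,g''_s)` with `g''_j = g'_j g₀`;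
here `k = s - m`. -/
def pairedDegrees [Group G] {m k : ℕ} (g₀ : G) (g : Fin m → G) (g' : Fin k → G) :
    Fin m ⊕ (Fin k ⊕ Fin k) → G :=
  Sum.elim g (Sum.elim g' fun j => g' j * g₀)

/-- The conditions on `g₀`, on an involution `ψ₀` of `D`, and on the numbers `m` and `k = s - m`. -/
structure IsAdmissible [Field F] [Group G] [Ring D] [Algebra F D]
    (𝒟 : G → Submodule F D) (g₀ : G) (ψ₀ : D → D) (m k : ℕ) : Prop where
  involution : IsTwistedDegreeInvertingInvolution 𝒟 g₀ ψ₀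
  eq_zero : g₀ ∉ gradedSupport 𝒟 → m = 0
  sq_eq_one : 0 < k → g₀ ^ 2 = 1

/-- The block matrix with blocks `I_m ⊗ x` and `[[0, I_k ⊗ y], [I_k ⊗ y, 0]]`. -/
def orthogonalForm [Ring D] (m k : ℕ) (x y : D) :
    Matrix (Fin m ⊕ (Fin k ⊕ Fin k)) (Fin m ⊕ (Fin k ⊕ Fin k)) D :=
  Matrix.fromBlocks (Matrix.diagonal fun _ => x) 0 0
    (Matrix.fromBlocks 0 (Matrix.diagonal fun _ => y) (Matrix.diagonal fun _ => y) 0)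

/-- The block matrix `[[0, I_k ⊗ y], [-I_k ⊗ y, 0]]`; it is only used for `m = 0`, when the first
block is empty. -/
def symplecticForm [Ring D] (m k : ℕ) (y : D) :
    Matrix (Fin m ⊕ (Fin k ⊕ Fin k)) (Fin m ⊕ (Fin k ⊕ Fin k)) D :=
  Matrix.fromBlocks 0 0 0
    (Matrix.fromBlocks 0 (Matrix.diagonal fun _ => y) (-Matrix.diagonal fun _ => y) 0)

end GradedMatrixAlgebras

/-! Put e = e_{i₀i₀} in R = M_n(D); then Re is a graded right D-module with basis the e_{j i₀}. A
degree-inverting involution ψ gives the pairing (x, y) ↦ ψ(x)y on Re with values in the corner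
ψ(e)Re. Any nonzero homogeneous u in the corner generates it freely over eRe ≅ D
(`IsCornerElement.exists_eq_mul_single`). Dividing by u therefore gives a D-valued form whose
adjoint is ψ, and moving ψ(d) past u gives an anti-automorphism α of D
(`IsCornerElement.exists_map`).

If ψ(u) = ±u, then α is an involution and the form is hermitian or skew-hermitian. Since D_1 = F,
this happens as soon as the degree r of u satisfies r² = 1. When the corner has no element of degree
1, such a u comes from a Frobenius–Schur argument. Identifying the corner with D, ψ becomes L(d) =
α(d)δ, which permutes the homogeneous components and has trace 0 if it fixes none. But D ≅ M_l(F),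
so L(d) = g dᵗ N, and L² = 1 forces g Nᵗ to be a nonzero scalar c; hence tr L = c l. This is nonzero
because l ≠ 0 in F: the identity component is a trace function on D taking the value 1 at 1. A fixed
component supplies u with r² = 1 (`IsCornerElement.exists_sq_eq_one`).

The Gram matrix is then reduced by Gram–Schmidt (`IsGradedGramMatrix.hasHyperbolicForm`). A nonzero
diagonal entry has degree g₀⁻¹, so g₀ lies in T, so g₀ = 1 by the choice of u; the entry is a
scalar, and a square root rescales it to 1. If the diagonal vanishes, a nonzero off-diagonal entry
spans a hyperbolic plane with degrees g' and g'g₀. No assumption on the characteristic enters.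

Conversely, the monomial form that pairs partner indices defines the involution directly
(`exists_matrix_involution`). If g₀ ∈ T, conjugating ψ₀ by an element of D_{g₀} first reduces to g₀
= 1. -/

section GradedDivisionAlgebras

variable {F G D : Type*} [Field F] [Group G] [Ring D] [Algebra F D] {𝒟 : G → Submodule F D}

/-! ### Homogeneous components of a graded algebra -/

namespace IsGroupGrading

theorem induction (h : IsGroupGrading 𝒟) {motive : D → Prop}
    (mem : ∀ g, ∀ d ∈ 𝒟 g, motive d) (add : ∀ a b, motive a → motive b → motive (a + b)) (d : D) :
    motive d :=
  Submodule.iSup_induction 𝒟 (motive := motive) (by rw [h.spanning]; trivial) mem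
    (mem 1 0 (zero_mem _)) add

theorem isInternal [DecidableEq G] (h : IsGroupGrading 𝒟) : DirectSum.IsInternal 𝒟 :=
  DirectSum.isInternal_submodule_of_iSupIndep_of_iSup_eq_top h.independent h.spanning

/-- The homogeneous component of degree `g`. -/
noncomputable def component (h : IsGroupGrading 𝒟) (g : G) : D →ₗ[F] D := by
  classical
  exact (𝒟 g).subtype ∘ₗ DirectSum.component F G (fun g => 𝒟 g) g ∘ₗ
    (LinearEquiv.ofBijective (DirectSum.coeLinearMap 𝒟) h.isInternal).symm.toLinearMap

theorem component_mem (h : IsGroupGrading 𝒟) (g : G) (d : D) : h.component g d ∈ 𝒟 g := by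
  classical
  simp [component]

theorem component_of_mem (h : IsGroupGrading 𝒟) {g : G} {d : D} (hd : d ∈ 𝒟 g) :
    h.component g d = d := by
  classical
  exact congrArg Subtype.val (h.isInternal.ofBijective_coeLinearMap_same ⟨d, hd⟩)

theorem component_of_ne (h : IsGroupGrading 𝒟) {g k : G} (hgk : g ≠ k) {d : D} (hd : d ∈ 𝒟 g) :
    h.component k d = 0 := by
  classical
  exact congrArg Subtype.val (h.isInternal.ofBijective_coeLinearMap_of_ne hgk ⟨d, hd⟩)

theorem component_mul_left (h : IsGroupGrading 𝒟) {t : G} {d : D} (hd : d ∈ 𝒟 t) (g : G) (y : D) :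
    h.component (t * g) (d * y) = d * h.component g y := by
  induction y using h.induction with
  | mem k y hy =>
    by_cases hk : k = g
    · subst hk
      rw [h.component_of_mem (h.mul_mem hd hy), h.component_of_mem hy]
    · rw [h.component_of_ne (by simpa using hk) (h.mul_mem hd hy), h.component_of_ne hk hy,
        mul_zero]
  | add a b ha hb => rw [mul_add, map_add, ha, hb, map_add, mul_add]

theorem component_mul_right (h : IsGroupGrading 𝒟) {t : G} {d : D} (hd : d ∈ 𝒟 t) (g : G) (y : D) :
    h.component (g * t) (y * d) = h.component g y * d := by
  induction y using h.induction with
  | mem k y hy =>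
    by_cases hk : k = g
    · subst hk
      rw [h.component_of_mem (h.mul_mem hy hd), h.component_of_mem hy]
    · rw [h.component_of_ne (by simpa using hk) (h.mul_mem hy hd), h.component_of_ne hk hy,
        zero_mul]
  | add a b ha hb => rw [add_mul, map_add, ha, hb, map_add, add_mul]

/-- The identity component of 1 is a left identity, hence equals 1. -/
theorem one_mem (h : IsGroupGrading 𝒟) : (1 : D) ∈ 𝒟 1 := by
  have key : ∀ d : D, h.component 1 1 * d = d := by
    intro d
    induction d using h.induction with
    | mem g d hd =>
      have := h.component_mul_right hd 1 1
      rwa [one_mul, one_mul, h.component_of_mem hd, eq_comm] at this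
    | add a b ha hb => rw [mul_add, ha, hb]
  have := key 1
  rw [mul_one] at this
  exact this ▸ h.component_mem 1 1

theorem algebraMap_mem (h : IsGroupGrading 𝒟) (c : F) : algebraMap F D c ∈ 𝒟 1 := by
  rw [Algebra.algebraMap_eq_smul_one]
  exact (𝒟 1).smul_mem c h.one_mem

theorem mem_inv_of_mul_eq_one (h : IsGroupGrading 𝒟) {t : G} {d y : D} (hd : d ∈ 𝒟 t)
    (hdy : d * y = 1) (hyd : y * d = 1) : y ∈ 𝒟 t⁻¹ := by
  have h1 := h.component_mul_left hd t⁻¹ y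
  rw [hdy, mul_inv_cancel, h.component_of_mem h.one_mem] at h1
  have h2 : y = h.component t⁻¹ y := by
    rw [← one_mul (h.component _ _), ← hyd, mul_assoc, ← h1, mul_one]
  rw [h2]
  exact h.component_mem _ _

end IsGroupGrading

theorem mem_gradedSupport {F G A : Type*} [Field F] [Ring A] [Algebra F A]
    {𝒜 : G → Submodule F A} {g : G} :
    g ∈ gradedSupport 𝒜 ↔ ∃ a ∈ 𝒜 g, a ≠ 0 :=
  Submodule.ne_bot_iff _

/-! ### Graded division algebras and their supports -/

namespace IsGradedDivisionAlgebra

theorem nontrivial (h : IsGradedDivisionAlgebra 𝒟) : Nontrivial D :=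
  ⟨1, 0, h.one_ne_zero⟩

theorem exists_inv (h : IsGradedDivisionAlgebra 𝒟) {t : G} {d : D} (hd : d ∈ 𝒟 t) (h0 : d ≠ 0) :
    ∃ y ∈ 𝒟 t⁻¹, d * y = 1 ∧ y * d = 1 := by
  obtain ⟨u, rfl⟩ := h.isUnit_of_mem hd h0
  exact ⟨↑u⁻¹, h.mem_inv_of_mul_eq_one hd u.mul_inv u.inv_mul, u.mul_inv, u.inv_mul⟩

theorem one_mem_support (h : IsGradedDivisionAlgebra 𝒟) : (1 : G) ∈ gradedSupport 𝒟 :=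
  mem_gradedSupport.2 ⟨1, h.one_mem, h.one_ne_zero⟩

theorem mul_ne_zero (h : IsGradedDivisionAlgebra 𝒟) {s : G} {a b : D} (ha : a ∈ 𝒟 s)
    (ha0 : a ≠ 0) (hb0 : b ≠ 0) : a * b ≠ 0 := fun e =>
  hb0 ((h.isUnit_of_mem ha ha0).mul_right_eq_zero.1 e)

theorem mul_mem_support (h : IsGradedDivisionAlgebra 𝒟) {s t : G} (hs : s ∈ gradedSupport 𝒟)
    (ht : t ∈ gradedSupport 𝒟) : s * t ∈ gradedSupport 𝒟 := by
  obtain ⟨a, ha, ha0⟩ := mem_gradedSupport.1 hs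
  obtain ⟨b, hb, hb0⟩ := mem_gradedSupport.1 ht
  exact mem_gradedSupport.2 ⟨a * b, h.mul_mem ha hb, h.mul_ne_zero ha ha0 hb0⟩

theorem inv_mem_support (h : IsGradedDivisionAlgebra 𝒟) {s : G} (hs : s ∈ gradedSupport 𝒟) :
    s⁻¹ ∈ gradedSupport 𝒟 := by
  obtain ⟨a, ha, ha0⟩ := mem_gradedSupport.1 hs
  obtain ⟨b, hb, hab, -⟩ := h.exists_inv ha ha0
  refine mem_gradedSupport.2 ⟨b, hb, ?_⟩
  rintro rfl
  exact h.one_ne_zero (by rw [← hab, mul_zero])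

variable [IsAlgClosed F] [FiniteDimensional F D]

/-- For c in the spectrum of d, the element c - d is homogeneous and not invertible, hence zero. -/
theorem exists_algebraMap_eq (h : IsGradedDivisionAlgebra 𝒟) {d : D} (hd : d ∈ 𝒟 1) :
    ∃ c : F, algebraMap F D c = d := by
  have := h.nontrivial
  obtain ⟨c, hc⟩ := spectrum.nonempty_of_isAlgClosed_of_finiteDimensional F d
  refine ⟨c, ?_⟩
  by_contra hne
  exact hc (h.isUnit_of_mem ((𝒟 1).sub_mem (h.algebraMap_mem c) hd) (sub_ne_zero.2 hne))

/-- Homogeneous components are at most one-dimensional. -/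
theorem exists_smul_eq (h : IsGradedDivisionAlgebra 𝒟) {t : G} {a b : D} (ha : a ∈ 𝒟 t)
    (ha0 : a ≠ 0) (hb : b ∈ 𝒟 t) : ∃ c : F, b = c • a := by
  obtain ⟨y, hy, hay, hya⟩ := h.exists_inv ha ha0
  have hm : b * y ∈ 𝒟 1 := by simpa using h.mul_mem hb hy
  obtain ⟨c, hc⟩ := h.exists_algebraMap_eq hm
  exact ⟨c, by rw [Algebra.smul_def, hc, mul_assoc, hya, mul_one]⟩

/-- The identity component is a trace function. Only degrees s, t with st = 1 contribute, and there
b is a scalar multiple of a⁻¹, so a and b commute. -/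
theorem component_one_mul_comm (h : IsGradedDivisionAlgebra 𝒟) (a b : D) :
    h.component 1 (a * b) = h.component 1 (b * a) := by
  induction a using h.induction with
  | add a a' ha ha' => rw [add_mul, mul_add, map_add, map_add, ha, ha']
  | mem s a ha =>
    induction b using h.induction with
    | add b b' hb hb' => rw [mul_add, add_mul, map_add, map_add, hb, hb']
    | mem t b hb =>
      by_cases hst : s * t = 1
      · by_cases ha0 : a = 0
        · simp [ha0]
        · obtain ⟨y, hy, hay, hya⟩ := h.exists_inv ha ha0
          obtain ⟨c, hc⟩ := h.exists_algebraMap_eq (hst ▸ h.mul_mem ha hb)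
          have hb' : b = algebraMap F D c * y := by
            rw [Algebra.commutes, hc, ← mul_assoc, hya, one_mul]
          rw [← hc, hb', mul_assoc, hya, mul_one]
      · rw [h.component_of_ne hst (h.mul_mem ha hb), h.component_of_ne _ (h.mul_mem hb ha)]
        exact fun e => hst (by rw [mul_eq_one_iff_eq_inv] at e ⊢; rw [e, inv_inv])

end IsGradedDivisionAlgebra

end GradedDivisionAlgebras

/-! ### Anti-automorphisms of matrix algebras and their traces -/

namespace Matrix

variable {F : Type*} [Field F] {l : ℕ}

/-- Every automorphism of a matrix algebra over a field is inner. -/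
theorem exists_conj_of_algEquiv (f : Matrix (Fin l) (Fin l) F ≃ₐ[F] Matrix (Fin l) (Fin l) F) :
    ∃ g g' : Matrix (Fin l) (Fin l) F, g * g' = 1 ∧ ∀ d, f d = g * d * g' := by
  let t : Matrix (Fin l) (Fin l) F ≃ₐ[F] Module.End F (Fin l → F) := Matrix.toLinAlgEquiv'
  obtain ⟨T, hT⟩ := AlgEquiv.eq_linearEquivConjAlgEquiv ((t.symm.trans f).trans t)
  refine ⟨t.symm T.toLinearMap, t.symm T.symm.toLinearMap, ?_, fun d => ?_⟩
  · rw [← map_mul, ← map_one t.symm]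
    congr 1
    exact LinearMap.ext fun x => T.apply_symm_apply x
  · have h := DFunLike.congr_fun hT (t d)
    simp only [AlgEquiv.trans_apply, AlgEquiv.symm_apply_apply] at h
    apply t.injective
    rw [h, map_mul, map_mul, AlgEquiv.apply_symm_apply, AlgEquiv.apply_symm_apply]
    rfl

/-- Every linear anti-automorphism of a matrix algebra over a field is a conjugate of the
transposition. -/
theorem exists_eq_mul_transpose_mul
    {α : Matrix (Fin l) (Fin l) F →ₗ[F] Matrix (Fin l) (Fin l) F} (hα : Function.Injective α)
    (hmul : ∀ a b, α (a * b) = α b * α a) :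
    ∃ g g' : Matrix (Fin l) (Fin l) F, g * g' = 1 ∧ ∀ d, α d = g * dᵀ * g' := by
  have hsurj : Function.Surjective α := LinearMap.injective_iff_surjective.1 hα
  have h1 : α 1 = 1 := by
    obtain ⟨x, hx⟩ := hsurj 1
    simpa [hx] using (hmul x 1).symm
  let f₀ : Matrix (Fin l) (Fin l) F →ₐ[F] Matrix (Fin l) (Fin l) F :=
    AlgHom.ofLinearMap (α ∘ₗ (transposeLinearEquiv (Fin l) (Fin l) F F).toLinearMap)
      (by simpa using h1) (fun a b => by simp [hmul])
  have hf₀ : ∀ d, f₀ d = α dᵀ := fun _ => rfl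
  obtain ⟨g, g', hg, hf⟩ := exists_conj_of_algEquiv (AlgEquiv.ofBijective f₀
    ⟨fun a b h => transpose_injective (hα h), fun y => by
      obtain ⟨x, hx⟩ := hsurj y
      exact ⟨xᵀ, by rw [hf₀, transpose_transpose, hx]⟩⟩)
  refine ⟨g, g', hg, fun d => ?_⟩
  have : α dᵀᵀ = g * dᵀ * g' := hf dᵀ
  rwa [transpose_transpose] at this

/-- On the basis of matrix units, the (i, j) coefficient of g e_{ji} N is g_{ij} N_{ij}. -/
theorem trace_mul_transpose_mul (g N : Matrix (Fin l) (Fin l) F)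
    {L : Matrix (Fin l) (Fin l) F →ₗ[F] Matrix (Fin l) (Fin l) F} (hL : ∀ d, L d = g * dᵀ * N) :
    LinearMap.trace F _ L = (g * Nᵀ).trace := by
  rw [LinearMap.trace_eq_matrix_trace F (stdBasis F (Fin l) (Fin l)), trace, trace,
    Fintype.sum_prod_type]
  refine Finset.sum_congr rfl fun i _ => ?_
  rw [diag_apply, mul_apply]
  refine Finset.sum_congr rfl fun j _ => ?_
  rw [diag_apply, LinearMap.toMatrix_apply, stdBasis_eq_single, hL, transpose_single]
  have : ∀ M : Matrix (Fin l) (Fin l) F, (stdBasis F (Fin l) (Fin l)).repr M (i, j) = M i j :=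
    fun _ => rfl
  rw [this, mul_apply, Finset.sum_eq_single i]
  · simp
  · intro k _ hk
    rw [mul_single_apply_of_ne _ _ _ _ _ hk, zero_mul]
  · simp

/-- If `α` is a linear anti-automorphism of `M_l(F)` and `d ↦ α(d) δ` is an involution, then the
trace of the latter is nonzero, provided that `l ≠ 0` in `F`. -/
theorem trace_antiautomorphism_mul_ne_zero (hl : (l : F) ≠ 0)
    {α L : Matrix (Fin l) (Fin l) F →ₗ[F] Matrix (Fin l) (Fin l) F}
    (hmul : ∀ a b, α (a * b) = α b * α a) {δ : Matrix (Fin l) (Fin l) F}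
    (hL : ∀ d, L d = α d * δ) (hLL : ∀ d, L (L d) = d) : LinearMap.trace F _ L ≠ 0 := by
  obtain ⟨g, g', hg, hα⟩ := exists_eq_mul_transpose_mul (α := α) (fun a b h => by
    rw [← hLL a, ← hLL b, hL a, hL b, h]) hmul
  have hL' : ∀ d, L d = g * dᵀ * (g' * δ) := fun d => by rw [hL, hα, Matrix.mul_assoc _ g' δ]
  set N := g' * δ
  -- This is L² = 1 written out. Taking d = 1 shows that the outer factors are inverse to each
  -- other, so g Nᵗ commutes with every matrix and is a scalar.
  have hd : ∀ d, (g * Nᵀ) * d * (gᵀ * N) = d := fun d => by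
    conv_rhs => rw [← hLL d, hL', hL']
    simp only [transpose_mul, transpose_transpose, Matrix.mul_assoc]
  have h1 : (g * Nᵀ) * (gᵀ * N) = 1 := by simpa using hd 1
  have h2 : (gᵀ * N) * (g * Nᵀ) = 1 := mul_eq_one_comm.1 h1
  obtain ⟨c, hc⟩ := (mem_range_scalar_iff_commute_single' (M := g * Nᵀ)).2 fun i j => by
    have := congrArg (· * (g * Nᵀ)) (hd (single i j 1))
    simp only [Matrix.mul_assoc _ (gᵀ * N), h2, Matrix.mul_one] at this
    exact this.symm
  rw [trace_mul_transpose_mul g N hL', ← hc]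
  have hc0 : c ≠ 0 := by
    rintro rfl
    rw [← hc, map_zero, Matrix.zero_mul] at h1
    have : l ≠ 0 := by rintro rfl; simp at hl
    have := congrFun (congrFun h1 ⟨0, by omega⟩) ⟨0, by omega⟩
    simp at this
  simp [trace, hc0, hl]

end Matrix

/-! ### The trace obstruction on a graded matrix algebra -/

section GradedDivisionAlgebras

variable {F G D : Type*} [Field F] [Group G] [Ring D] [Algebra F D]
  {𝒟 : G → Submodule F D} {l : ℕ}

theorem exists_algebraMap_eq_of_mem_center (e : D ≃ₐ[F] Matrix (Fin l) (Fin l) F) {z : D}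
    (hz : z ∈ Subring.center D) : ∃ c : F, algebraMap F D c = z := by
  obtain ⟨c, hc⟩ := (Matrix.mem_range_scalar_iff_commute_single' (M := e z)).2 fun i j => by
    have := congrArg e (Subring.mem_center_iff.1 hz (e.symm (Matrix.single i j 1)))
    simpa [Commute, SemiconjBy] using this
  refine ⟨c, e.injective ?_⟩
  rw [AlgEquiv.commutes, ← hc]
  rfl

namespace IsGradedDivisionAlgebra

variable [IsAlgClosed F]

/-- A trace function takes the same value on all diagonal matrix units, so its value at 1 is l times
that value; for the identity component of D the value at 1 is 1. -/
theorem natCast_ne_zero (h : IsGradedDivisionAlgebra 𝒟) (e : D ≃ₐ[F] Matrix (Fin l) (Fin l) F) :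
    (l : F) ≠ 0 := by
  have : FiniteDimensional F D := e.symm.toLinearEquiv.finiteDimensional
  intro hl
  have hl0 : l ≠ 0 := by
    rintro rfl
    exact h.one_ne_zero (e.injective (Subsingleton.elim _ _))
  let i₀ : Fin l := ⟨0, by omega⟩
  have key : ∀ i, h.component 1 (e.symm (Matrix.single i i 1)) =
      h.component 1 (e.symm (Matrix.single i₀ i₀ 1)) := fun i => by
    have h1 : (Matrix.single i i 1 : Matrix (Fin l) (Fin l) F) =
      Matrix.single i i₀ 1 * Matrix.single i₀ i 1 := by simp
    have h2 : (Matrix.single i₀ i₀ 1 : Matrix (Fin l) (Fin l) F) =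
      Matrix.single i₀ i 1 * Matrix.single i i₀ 1 := by simp
    rw [h1, h2, map_mul e.symm, map_mul e.symm, h.component_one_mul_comm]
  have h1 : h.component 1 (e.symm 1) = 1 := by rw [map_one, h.component_of_mem h.one_mem]
  rw [← Matrix.sum_single_one, map_sum, map_sum, Finset.sum_congr rfl fun i _ => key i,
    Finset.sum_const, Finset.card_univ, Fintype.card_fin, ← Nat.cast_smul_eq_nsmul F, hl,
    zero_smul] at h1
  exact h.one_ne_zero h1.symm

/-- A homogeneity version of the Frobenius–Schur argument: if `α` is an anti-automorphism and
`L(d) = α(d) δ` is involutive and permutes the homogeneous components, then `L` maps some nonzero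
homogeneous component to itself. -/
theorem exists_mem_fixed_degree (h : IsGradedDivisionAlgebra 𝒟)
    (e : D ≃ₐ[F] Matrix (Fin l) (Fin l) F) {α L : D →ₗ[F] D}
    (hmul : ∀ a b, α (a * b) = α b * α a) {δ : D} (hL : ∀ d, L d = α d * δ)
    (hLL : ∀ d, L (L d) = d) (σ : G → G) (hσ : ∀ t, ∀ d ∈ 𝒟 t, L d ∈ 𝒟 (σ t)) :
    ∃ t ∈ gradedSupport 𝒟, σ t = t := by
  classical
  have : FiniteDimensional F D := e.symm.toLinearEquiv.finiteDimensional
  by_contra! hne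
  have h0 := LinearMap.trace_eq_zero_of_mapsTo_ne h.isInternal
    -- Off the support σ is uncontrolled and could have fixed points. The value 1 is safe there,
    -- since 1 belongs to the support.
    (fun t => if t ∈ gradedSupport 𝒟 then σ t else 1) (f := L) (fun t => by
      split_ifs with ht
      · exact hne t ht
      · rintro rfl
        exact ht h.one_mem_support) fun t d hd => by
      split_ifs with ht
      · exact hσ t d hd
      · have : d = 0 := by
          by_contra hd0
          exact ht (mem_gradedSupport.2 ⟨d, hd, hd0⟩)
        simp [this]
  rw [← LinearMap.trace_conj' L e.toLinearEquiv] at h0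
  refine Matrix.trace_antiautomorphism_mul_ne_zero (h.natCast_ne_zero e)
    (α := e.toLinearEquiv.conj α) (L := e.toLinearEquiv.conj L) (δ := e δ) ?_ ?_ ?_ h0
  · simp [LinearEquiv.conj_apply, hmul]
  · simp [LinearEquiv.conj_apply, hL]
  · simp [LinearEquiv.conj_apply, hLL]

end IsGradedDivisionAlgebra

end GradedDivisionAlgebras

/-! ### The corner ψ(e)Re as a free module of rank one over D -/

section MatrixGrading

variable {F G D ι κ : Type*} [Field F] [Group G] [Ring D] [Algebra F D] {𝒟 : G → Submodule F D}

theorem apply_mem_of_mem_matrixGrading {γ : ι → G} {g : G} {X : Matrix ι ι D}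
    (hX : X ∈ matrixGrading 𝒟 γ g) (i j : ι) : X i j ∈ 𝒟 ((γ i)⁻¹ * g * γ j) :=
  hX i j

theorem matrixGrading_mul_mem [Fintype ι] (h : IsGroupGrading 𝒟) {γ : ι → G} {r s : G}
    {Y Z : Matrix ι ι D} (hY : Y ∈ matrixGrading 𝒟 γ r) (hZ : Z ∈ matrixGrading 𝒟 γ s) :
    Y * Z ∈ matrixGrading 𝒟 γ (r * s) := fun i j => by
  rw [Matrix.mul_apply]
  refine Submodule.sum_mem _ fun k _ => ?_
  have := h.mul_mem (hY i k) (hZ k j)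
  simpa [mul_assoc] using this

theorem single_mem_matrixGrading [DecidableEq ι] {γ : ι → G} {t : G} {d : D} (hd : d ∈ 𝒟 t)
    (i j : ι) : Matrix.single i j d ∈ matrixGrading 𝒟 γ (γ i * t * (γ j)⁻¹) := fun k l => by
  rw [Matrix.single_apply]
  split_ifs with hkl
  · obtain ⟨rfl, rfl⟩ := hkl
    simpa [mul_assoc] using hd
  · exact zero_mem _

theorem single_one_mem_matrixGrading [DecidableEq ι] {γ : ι → G} (h : IsGroupGrading 𝒟)
    (i j : ι) :
    Matrix.single i j (1 : D) ∈ matrixGrading 𝒟 γ (γ i * (γ j)⁻¹) := by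
  simpa using single_mem_matrixGrading (γ := γ) h.one_mem i j

theorem mem_of_mul_single_mem [Fintype ι] [DecidableEq ι] (h : IsGradedDivisionAlgebra 𝒟)
    {γ : ι → G} {i₀ : ι} {r s : G} {u : Matrix ι ι D} (hu : u ∈ matrixGrading 𝒟 γ r)
    {i : ι} (hi : u i i₀ ≠ 0) {d : D}
    (hd : u * Matrix.single i₀ i₀ d ∈ matrixGrading 𝒟 γ s) :
    d ∈ 𝒟 ((γ i₀)⁻¹ * r⁻¹ * s * γ i₀) := by
  obtain ⟨y, hy, -, hyu⟩ := h.exists_inv (apply_mem_of_mem_matrixGrading hu i i₀) hi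
  have h1 := apply_mem_of_mem_matrixGrading hd i i₀
  rw [Matrix.mul_single_apply_same] at h1
  have h2 := h.mul_mem hy h1
  rw [← mul_assoc y, hyu, one_mul] at h2
  simpa [mul_assoc] using h2

namespace IsInvolution

theorem map_zero {A : Type*} [Ring A] {ψ : A → A} (h : IsInvolution ψ) : ψ 0 = 0 := by
  simpa using h.map_add 0 0

theorem map_one {A : Type*} [Ring A] {ψ : A → A} (h : IsInvolution ψ) : ψ 1 = 1 := by
  have := h.map_mul 1 (ψ 1)
  rwa [one_mul, h.involutive, one_mul, eq_comm] at this

theorem map_sum {A α : Type*} [Ring A] {ψ : A → A} (h : IsInvolution ψ) (s : Finset α)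
    (f : α → A) : ψ (∑ i ∈ s, f i) = ∑ i ∈ s, ψ (f i) := by
  classical
  induction s using Finset.induction_on with
  | empty => simp [h.map_zero]
  | insert a s ha ih => rw [Finset.sum_insert ha, Finset.sum_insert ha, h.map_add, ih]

theorem map_algebraMap_mul {A : Type*} [Ring A] [Algebra F A] {ψ : A → A} (h : IsInvolution ψ)
    (c : F) (a : A) : ψ (algebraMap F A c * a) = algebraMap F A c * ψ a :=
  h.map_center_mul _ (Subring.mem_center_iff.2 fun g => (Algebra.commutes c g).symm) a

theorem map_smul {A : Type*} [Ring A] [Algebra F A] {ψ : A → A} (h : IsInvolution ψ)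
    (c : F) (a : A) : ψ (c • a) = c • ψ a := by
  rw [Algebra.smul_def, h.map_algebraMap_mul, ← Algebra.smul_def]

theorem map_algebraMap {A : Type*} [Ring A] [Algebra F A] {ψ : A → A} (h : IsInvolution ψ)
    (c : F) : ψ (algebraMap F A c) = algebraMap F A c := by
  simpa [h.map_one] using h.map_algebraMap_mul c 1

theorem injective {A : Type*} [Ring A] {ψ : A → A} (h : IsInvolution ψ) :
    Function.Injective ψ := fun a b hab => by rw [← h.involutive a, hab, h.involutive]

end IsInvolution

open Matrix

variable [Fintype ι] [DecidableEq ι]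

/-- `u` is a nonzero homogeneous element of degree `r` in `ψ(e) R e`, where `e` is the matrix unit
`e_{i₀ i₀}` of `R = M_ι(D)`. -/
structure IsCornerElement (𝒟 : G → Submodule F D) (γ : ι → G) (ψ : Matrix ι ι D → Matrix ι ι D)
    (i₀ : ι) (r : G) (u : Matrix ι ι D) : Prop where
  mem : u ∈ matrixGrading 𝒟 γ r
  left : ψ (single i₀ i₀ 1) * u = u
  right : u * single i₀ i₀ 1 = u
  ne_zero : u ≠ 0

namespace IsCornerElement

variable {γ : ι → G} {ψ : Matrix ι ι D → Matrix ι ι D} {i₀ : ι} {r : G} {u : Matrix ι ι D}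

theorem exists_apply_ne_zero (hu : IsCornerElement 𝒟 γ ψ i₀ r u) : ∃ i, u i i₀ ≠ 0 := by
  by_contra! h0
  apply hu.ne_zero
  rw [← hu.right]
  ext i j
  by_cases hj : j = i₀
  · subst hj; simp [h0]
  · rw [mul_single_apply_of_ne _ _ _ _ _ hj]; rfl

theorem eq_zero_of_mul_single (h : IsGradedDivisionAlgebra 𝒟)
    (hu : IsCornerElement 𝒟 γ ψ i₀ r u) {d : D} (hd : u * single i₀ i₀ d = 0) : d = 0 := by
  obtain ⟨i, hi⟩ := hu.exists_apply_ne_zero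
  have := congrFun (congrFun hd i) i₀
  rw [mul_single_apply_same, Matrix.zero_apply] at this
  by_contra hd0
  exact h.mul_ne_zero (apply_mem_of_mem_matrixGrading hu.mem i i₀) hi hd0 this

theorem cancel (h : IsGradedDivisionAlgebra 𝒟) (hu : IsCornerElement 𝒟 γ ψ i₀ r u) {c d : D}
    (hcd : u * single i₀ i₀ c = u * single i₀ i₀ d) : c = d := by
  refine sub_eq_zero.1 (hu.eq_zero_of_mul_single h ?_)
  rw [← sub_eq_zero.2 hcd, ← Matrix.mul_sub]
  congr 1
  ext i j
  simp only [single_apply, Matrix.sub_apply]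
  split_ifs <;> simp

theorem mem_degree (h : IsGradedDivisionAlgebra 𝒟) (hu : IsCornerElement 𝒟 γ ψ i₀ r u) {s : G}
    {d : D} (hd : u * single i₀ i₀ d ∈ matrixGrading 𝒟 γ s) :
    d ∈ 𝒟 ((γ i₀)⁻¹ * r⁻¹ * s * γ i₀) :=
  have ⟨_, hi⟩ := hu.exists_apply_ne_zero
  mem_of_mul_single_mem h hu.mem hi hd

theorem eq_single_of_corner {y : Matrix ι ι D}
    (hl : single i₀ i₀ 1 * y = y) (hr : y * single i₀ i₀ 1 = y) :
    y = single i₀ i₀ (y i₀ i₀) := by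
  conv_lhs => rw [← hr, ← hl]
  rw [single_mul_mul_single]
  simp

/-- With f = ψ(e), some w = u e_{i₀k} f is a nonzero homogeneous element of f R f = ψ(eRe), so ψ(w)
is a homogeneous unit of D placed in the corner e. Dividing it out of w gives v. -/
theorem exists_right_inverse (h : IsGradedDivisionAlgebra 𝒟)
    (hψ : IsDegreeInvertingInvolution (matrixGrading 𝒟 γ) ψ)
    (hu : IsCornerElement 𝒟 γ ψ i₀ r u) :
    ∃ v, u * v = ψ (single i₀ i₀ 1) ∧ single i₀ i₀ 1 * v = v := by
  set f := ψ (single i₀ i₀ 1) with hf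
  have hff : f * f = f := by rw [hf, ← hψ.map_mul]; simp
  have hψf : ψ f = single i₀ i₀ 1 := hψ.involutive _
  have he : single i₀ i₀ (1 : D) ∈ matrixGrading 𝒟 γ 1 := by
    simpa using single_mem_matrixGrading (γ := γ) h.one_mem i₀ i₀
  have hf1 : f ∈ matrixGrading 𝒟 γ 1 := by simpa using hψ.map_mem he
  have hf0 : ∃ k l, f k l ≠ 0 := by
    by_contra! h0
    have : f = 0 := by ext i j; exact h0 i j
    rw [this, hψ.map_zero] at hψf
    have := congrFun (congrFun hψf i₀) i₀
    rw [Matrix.zero_apply, single_apply_same] at this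
    exact h.one_ne_zero this.symm
  obtain ⟨k, l, hkl⟩ := hf0
  obtain ⟨i, hi⟩ := hu.exists_apply_ne_zero
  set w := u * (single i₀ k 1 * f) with hw
  have hw0 : w ≠ 0 := fun h0 => by
    have := congrFun (congrFun h0 i) l
    rw [hw, ← Matrix.mul_assoc, mul_apply, Finset.sum_eq_single k] at this
    · rw [mul_single_apply_same, mul_one] at this
      exact h.mul_ne_zero (apply_mem_of_mem_matrixGrading hu.mem i i₀) hi hkl this
    · intro b _ hb
      rw [mul_single_apply_of_ne _ _ _ _ _ hb, zero_mul]
    · simp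
  have hψw := hψ.map_mem (matrixGrading_mul_mem h.toIsGroupGrading hu.mem
    (matrixGrading_mul_mem h.toIsGroupGrading
      (single_mem_matrixGrading (γ := γ) h.one_mem i₀ k) hf1))
  rw [← hw] at hψw
  have hc := eq_single_of_corner (i₀ := i₀) (y := ψ w)
    (by rw [← hψf, ← hψ.map_mul, hw, Matrix.mul_assoc, Matrix.mul_assoc, hff])
    (by rw [← hψf, ← hψ.map_mul, hw, ← Matrix.mul_assoc f, hu.left])
  have hc0 : ψ w i₀ i₀ ≠ 0 := fun h0 => by
    rw [h0, single_zero] at hc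
    exact hw0 (by rw [← hψ.involutive w, hc, hψ.map_zero])
  obtain ⟨c', -, -, hc'⟩ := h.exists_inv (apply_mem_of_mem_matrixGrading hψw i₀ i₀) hc0
  refine ⟨single i₀ k 1 * f * ψ (single i₀ i₀ c'), ?_, ?_⟩
  · rw [← Matrix.mul_assoc, ← hw, ← hψ.involutive w, hc, ← hψ.map_mul, single_mul_single_same, hc']
  · rw [← Matrix.mul_assoc, ← Matrix.mul_assoc, single_mul_single_same, one_mul]

/-- Since ψ(e) = uv, y = ψ(e)y = u(vy), and vy lies in eRe. -/
theorem exists_eq_mul_single (h : IsGradedDivisionAlgebra 𝒟)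
    (hψ : IsDegreeInvertingInvolution (matrixGrading 𝒟 γ) ψ)
    (hu : IsCornerElement 𝒟 γ ψ i₀ r u) {y : Matrix ι ι D}
    (hl : ψ (single i₀ i₀ 1) * y = y) (hr : y * single i₀ i₀ 1 = y) :
    ∃ d, y = u * single i₀ i₀ d := by
  obtain ⟨v, huv, hv⟩ := hu.exists_right_inverse h hψ
  refine ⟨(v * y) i₀ i₀, ?_⟩
  rw [← eq_single_of_corner (i₀ := i₀) (y := v * y) (by rw [← Matrix.mul_assoc, hv])
    (by rw [Matrix.mul_assoc, hr]), ← Matrix.mul_assoc, huv, hl]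

theorem exists_map (h : IsGradedDivisionAlgebra 𝒟)
    (hψ : IsDegreeInvertingInvolution (matrixGrading 𝒟 γ) ψ)
    (hu : IsCornerElement 𝒟 γ ψ i₀ r u) :
    ∃ α : D →ₗ[F] D, (∀ d, ψ (single i₀ i₀ d) * u = u * single i₀ i₀ (α d)) ∧
      ∀ a b, α (a * b) = α b * α a := by
  have ex : ∀ d, ∃ d', ψ (single i₀ i₀ d) * u = u * single i₀ i₀ d' := fun d =>
    hu.exists_eq_mul_single h hψ (y := ψ (single i₀ i₀ d) * u)
      (by rw [← Matrix.mul_assoc, ← hψ.map_mul, single_mul_single_same, mul_one])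
      (by rw [Matrix.mul_assoc, hu.right])
  choose α hα using ex
  refine ⟨{ toFun := α, map_add' := fun a b => hu.cancel h ?_, map_smul' := fun c a =>
    hu.cancel h ?_ }, hα, fun a b => hu.cancel h ?_⟩
  · rw [← hα, single_add, single_add, hψ.map_add, Matrix.add_mul, hα, hα, Matrix.mul_add]
  · rw [← hα, RingHom.id_apply, ← smul_single, hψ.map_smul, smul_mul_assoc, hα, ← mul_smul_comm,
      smul_single]
  · change u * single i₀ i₀ (α (a * b)) = u * single i₀ i₀ (α b * α a)
    rw [← hα, ← single_mul_single_same a i₀ i₀ i₀ b, hψ.map_mul, Matrix.mul_assoc, hα,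
      ← Matrix.mul_assoc, hα, Matrix.mul_assoc, single_mul_single_same]

end IsCornerElement

end MatrixGrading

/-! ### Normalizing the corner element and constructing the form -/

section MatrixGrading

open Matrix

variable {F G D ι : Type*} [Field F] [Group G] [Ring D] [Algebra F D] {𝒟 : G → Submodule F D}
  [Fintype ι] [DecidableEq ι]
variable {γ : ι → G} {ψ : Matrix ι ι D → Matrix ι ι D}

theorem exists_isCornerElement (h : IsGradedDivisionAlgebra 𝒟)
    (hψ : IsDegreeInvertingInvolution (matrixGrading 𝒟 γ) ψ) (i₀ : ι) :
    ∃ r u, IsCornerElement 𝒟 γ ψ i₀ r u := by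
  set f := ψ (single i₀ i₀ 1) with hf
  have hff : f * f = f := by rw [hf, ← hψ.map_mul]; simp
  have hf1 : f ∈ matrixGrading 𝒟 γ 1 := by
    simpa using hψ.map_mem (single_one_mem_matrixGrading (γ := γ) h.toIsGroupGrading i₀ i₀)
  have hf0 : ∃ l k, f l k ≠ 0 := by
    by_contra! h0
    have : f = 0 := by ext i j; exact h0 i j
    have := hψ.injective (hf.symm.trans (this.trans hψ.map_zero.symm))
    have := congrFun (congrFun this i₀) i₀
    rw [Matrix.zero_apply, single_apply_same] at this
    exact h.one_ne_zero this
  obtain ⟨l, k, hlk⟩ := hf0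
  refine ⟨_, f * single k i₀ 1, matrixGrading_mul_mem h.toIsGroupGrading hf1
    (single_one_mem_matrixGrading h.toIsGroupGrading k i₀), ?_, ?_, fun h0 => ?_⟩
  · rw [← hf, ← Matrix.mul_assoc, hff]
  · rw [Matrix.mul_assoc, single_mul_single_same, mul_one]
  · have := congrFun (congrFun h0 l) i₀
    rw [mul_single_apply_same, mul_one] at this
    exact hlk this

namespace IsCornerElement

variable {i₀ : ι} {r : G} {u : Matrix ι ι D}

theorem mul_single (h : IsGradedDivisionAlgebra 𝒟) (hu : IsCornerElement 𝒟 γ ψ i₀ r u) {t : G}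
    {d : D} (hd : d ∈ 𝒟 t) (hd0 : d ≠ 0) :
    IsCornerElement 𝒟 γ ψ i₀ (r * (γ i₀ * t * (γ i₀)⁻¹)) (u * single i₀ i₀ d) where
  mem := matrixGrading_mul_mem h.toIsGroupGrading hu.mem (single_mem_matrixGrading hd i₀ i₀)
  left := by rw [← Matrix.mul_assoc, hu.left]
  right := by rw [Matrix.mul_assoc, single_mul_single_same, mul_one]
  ne_zero h0 := hd0 (hu.eq_zero_of_mul_single h h0)

/-- The involution maps `ψ(e) R e` to itself. -/
theorem exists_map_eq (h : IsGradedDivisionAlgebra 𝒟)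
    (hψ : IsDegreeInvertingInvolution (matrixGrading 𝒟 γ) ψ)
    (hu : IsCornerElement 𝒟 γ ψ i₀ r u) : ∃ d, ψ u = u * single i₀ i₀ d :=
  hu.exists_eq_mul_single h hψ (by rw [← hψ.map_mul, hu.right])
    (by conv_lhs => rw [← hψ.involutive (single i₀ i₀ 1), ← hψ.map_mul, hu.left])

/-- There is a corner element of degree `r` with `r² = 1`; moreover `r = 1` if possible. -/
theorem exists_sq_eq_one [IsAlgClosed F] {l : ℕ} (h : IsGradedDivisionAlgebra 𝒟)
    (e : D ≃ₐ[F] Matrix (Fin l) (Fin l) F)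
    (hψ : IsDegreeInvertingInvolution (matrixGrading 𝒟 γ) ψ)
    (hu : IsCornerElement 𝒟 γ ψ i₀ r u) :
    ∃ r' u', IsCornerElement 𝒟 γ ψ i₀ r' u' ∧ r' * r' = 1 ∧
      ((γ i₀)⁻¹ * r' * γ i₀ ∈ gradedSupport 𝒟 → r' = 1) := by
  by_cases hr : (γ i₀)⁻¹ * r * γ i₀ ∈ gradedSupport 𝒟
  · obtain ⟨d, hd, hd0⟩ := mem_gradedSupport.1 (h.inv_mem_support hr)
    refine ⟨_, _, hu.mul_single h hd hd0, ?_⟩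
    simp [mul_assoc]
  obtain ⟨α, hα, hαmul⟩ := hu.exists_map h hψ
  obtain ⟨δ, hδ⟩ := hu.exists_map_eq h hψ
  set L : D →ₗ[F] D := LinearMap.mulRight F δ ∘ₗ α with hLdef
  have hL : ∀ d, L d = α d * δ := fun _ => rfl
  have hψL : ∀ d, ψ (u * single i₀ i₀ d) = u * single i₀ i₀ (L d) := fun d => by
    rw [hψ.map_mul, hδ, ← Matrix.mul_assoc, hα, Matrix.mul_assoc, single_mul_single_same, hL]
  -- For d of degree t, σ(t) is the degree of L(d), and σ(t) = t says exactly that the degree of the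
  -- corner element u d is its own inverse.
  obtain ⟨t, ht, hσ⟩ := h.exists_mem_fixed_degree e (α := α) (L := L) hαmul (δ := δ) hL
    (fun d => hu.cancel h (by rw [← hψL, ← hψL, hψ.involutive]))
    (fun t => (γ i₀)⁻¹ * r⁻¹ * (r * (γ i₀ * t * (γ i₀)⁻¹))⁻¹ * γ i₀) (fun t d hd => by
      refine hu.mem_degree h ?_
      rw [← hψL]
      exact hψ.map_mem (matrixGrading_mul_mem h.toIsGroupGrading hu.mem
        (single_mem_matrixGrading hd i₀ i₀)))
  obtain ⟨d, hd, hd0⟩ := mem_gradedSupport.1 ht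
  refine ⟨_, _, hu.mul_single h hd hd0, ?_, fun hT => ?_⟩
  · conv_lhs => enter [2, 2, 1, 2]; rw [← hσ]
    group
  -- The conjugated degree of u changes by t ∈ T, so it stays outside T and the last clause is
  -- vacuous.
  · refine absurd ?_ hr
    convert h.mul_mem_support hT (h.inv_mem_support ht) using 1
    group

/-- As r⁻¹ = r, ψ(u) and u have the same degree, so ψ(u) = cu with c ∈ F, and ψ² = 1 gives c² = 1.
-/
theorem map_eq_or_eq_neg [IsAlgClosed F] [FiniteDimensional F D] (h : IsGradedDivisionAlgebra 𝒟)
    (hψ : IsDegreeInvertingInvolution (matrixGrading 𝒟 γ) ψ)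
    (hu : IsCornerElement 𝒟 γ ψ i₀ r u) (hr : r * r = 1) : ψ u = u ∨ ψ u = -u := by
  obtain ⟨d, hd⟩ := hu.exists_map_eq h hψ
  have hd1 := hu.mem_degree h (hd ▸ hψ.map_mem hu.mem)
  have hri : r⁻¹ = r := inv_eq_of_mul_eq_one_left hr
  rw [hri, mul_assoc (γ i₀)⁻¹, hr, mul_one, inv_mul_cancel] at hd1
  obtain ⟨c, rfl⟩ := h.exists_algebraMap_eq hd1
  have hc : ψ u = c • u := by
    rw [hd, Algebra.algebraMap_eq_smul_one, ← smul_single, Matrix.mul_smul, hu.right]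
  have h2 : (c * c) • u = u := by
    conv_rhs => rw [← hψ.involutive u, hc, hψ.map_smul, hc, smul_smul]
  have hcc : c * c = 1 := by
    by_contra hne
    apply hu.ne_zero
    have : (c * c - 1) • u = 0 := by rw [sub_smul, h2, one_smul, sub_self]
    exact (smul_eq_zero.1 this).resolve_left (sub_ne_zero.2 hne)
  rcases mul_self_eq_one_iff.1 hcc with rfl | rfl
  · exact .inl (by simpa using hc)
  · exact .inr (by simpa using hc)

end IsCornerElement

theorem matrix_mul_single_eq_sum (Y : Matrix ι ι D) (i₀ j : ι) :
    Y * single j i₀ 1 = ∑ k, single k i₀ 1 * single i₀ i₀ (Y k j) := by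
  ext a b
  rw [Matrix.sum_apply]
  simp_rw [single_mul_single_same, one_mul]
  by_cases hb : b = i₀
  · subst hb
    rw [mul_single_apply_same, mul_one, Finset.sum_eq_single a]
    · rw [single_apply_same]
    · intro k _ hk
      rw [single_apply_of_row_ne hk]
    · simp
  · rw [mul_single_apply_of_ne _ _ _ _ _ hb]
    exact (Finset.sum_eq_zero fun k _ => single_apply_of_col_ne _ _ (Ne.symm hb) _).symm

theorem mul_single_sum {α : Type*} (u : Matrix ι ι D) (i₀ : ι) (s : Finset α) (f : α → D) :
    ∑ k ∈ s, u * single i₀ i₀ (f k) = u * single i₀ i₀ (∑ k ∈ s, f k) := by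
  rw [← Matrix.mul_sum]
  congr 1
  exact (map_sum (singleAddMonoidHom i₀ i₀) f s).symm

/-- `Γ` is the invertible Gram matrix, in a basis of degrees `γ`, of a homogeneous `ψ₀`-sesquilinear
form that is hermitian (`ε = 1`) or skew-hermitian (`ε = -1`). -/
structure IsGradedGramMatrix {ι : Type*} [Fintype ι] [DecidableEq ι]
    (𝒟 : G → Submodule F D) (g₀ : G) (ψ₀ : D → D) (ε : D) (γ : ι → G)
    (Γ : Matrix ι ι D) : Prop where
  mem : ∀ i j, Γ i j ∈ 𝒟 (g₀⁻¹ * (γ i)⁻¹ * γ j)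
  symm : Γᵀ.map ψ₀ = ε • Γ
  exists_inv : ∃ Γ', Γ * Γ' = 1 ∧ Γ' * Γ = 1

/-- Every degree-inverting involution of `M_ι(D)` is the adjoint with respect to a form. -/
theorem exists_isGradedGramMatrix [IsAlgClosed F] [Nonempty ι] {l : ℕ}
    (h : IsGradedDivisionAlgebra 𝒟) (e : D ≃ₐ[F] Matrix (Fin l) (Fin l) F)
    (hψ : IsDegreeInvertingInvolution (matrixGrading 𝒟 γ) ψ) :
    ∃ (g₀ : G) (ψ₀ : D → D) (ε : D) (Γ : Matrix ι ι D),
      g₀ * g₀ = 1 ∧ (g₀ ∈ gradedSupport 𝒟 → g₀ = 1) ∧ (ε = 1 ∨ ε = -1) ∧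
      IsTwistedDegreeInvertingInvolution 𝒟 g₀ ψ₀ ∧ IsGradedGramMatrix 𝒟 g₀ ψ₀ ε γ Γ ∧
      ∀ Y, Yᵀ.map ψ₀ * Γ = Γ * ψ Y := by
  have : FiniteDimensional F D := e.symm.toLinearEquiv.finiteDimensional
  obtain ⟨i₀⟩ := ‹Nonempty ι›
  obtain ⟨r, u, hu, hr, hr1⟩ : ∃ r u, IsCornerElement 𝒟 γ ψ i₀ r u ∧ r * r = 1 ∧
      ((γ i₀)⁻¹ * r * γ i₀ ∈ gradedSupport 𝒟 → r = 1) := by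
    obtain ⟨r, u, hu⟩ := exists_isCornerElement h hψ i₀
    exact hu.exists_sq_eq_one h e hψ
  obtain ⟨ε, hε, hεs⟩ : ∃ ε : D, (ε = 1 ∨ ε = -1) ∧ ψ u = u * single i₀ i₀ ε := by
    rcases hu.map_eq_or_eq_neg h hψ hr with h1 | h1
    · exact ⟨1, .inl rfl, by rw [hu.right, h1]⟩
    · exact ⟨-1, .inr rfl, by rw [h1, ← single_neg, Matrix.mul_neg, hu.right]⟩
  obtain ⟨α, hα, hαmul⟩ := hu.exists_map h hψ
  have hεc : ∀ d : D, ε * d = d * ε := by rcases hε with rfl | rfl <;> simp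
  have hεε : ε * ε = 1 := by rcases hε with rfl | rfl <;> simp
  have hψε : ∀ d, ψ (u * single i₀ i₀ d) = u * single i₀ i₀ (α d * ε) := fun d => by
    rw [hψ.map_mul, hεs, ← Matrix.mul_assoc, hα, Matrix.mul_assoc, single_mul_single_same]
  have hαε : ∀ d, α (d * ε) = α d * ε := by rcases hε with rfl | rfl <;> simp
  have hαα : ∀ d, α (α d) = d := fun d => by
    refine hu.cancel h ?_
    have := hψ.involutive (u * single i₀ i₀ d)
    rw [hψε, hψε, hαε, mul_assoc, hεε, mul_one] at this
    exact this
  have ex : ∀ i j, ∃ d, ψ (single i i₀ 1) * single j i₀ 1 = u * single i₀ i₀ d := fun i j =>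
    hu.exists_eq_mul_single h hψ (y := ψ (single i i₀ 1) * single j i₀ 1)
      (by rw [← Matrix.mul_assoc, ← hψ.map_mul, single_mul_single_same, mul_one])
      (by rw [Matrix.mul_assoc, single_mul_single_same, mul_one])
  -- Γ i j is the value of the form on the basis vectors e_{i i₀} and e_{j i₀} of Re.
  choose Γ hΓ using ex
  have hmul : ∀ i j (Y : Matrix ι ι D), ψ (single i i₀ 1) * (Y * single j i₀ 1) =
      u * single i₀ i₀ ((Matrix.of Γ * Y) i j) := fun i j Y => by
    rw [matrix_mul_single_eq_sum, Matrix.mul_sum, mul_apply, ← mul_single_sum]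
    refine Finset.sum_congr rfl fun k _ => ?_
    rw [← Matrix.mul_assoc, hΓ, Matrix.mul_assoc, single_mul_single_same]
    rfl
  -- g₀ is the degree of u transported from the corner at i₀ to D.
  refine ⟨(γ i₀)⁻¹ * r * γ i₀, α, ε, Matrix.of Γ, ?_, ?_, hε, ?_, ⟨?_, ?_, ?_⟩, ?_⟩
  · rw [show (γ i₀)⁻¹ * r * γ i₀ * ((γ i₀)⁻¹ * r * γ i₀) = (γ i₀)⁻¹ * (r * r) * γ i₀ by group, hr]
    simp
  · intro hT
    simp [hr1 hT]
  · exact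
    { map_add := map_add α
      map_center_mul := fun z hz a => by
        obtain ⟨c, rfl⟩ := exists_algebraMap_eq_of_mem_center e hz
        rw [← Algebra.smul_def, map_smul, Algebra.smul_def]
      map_mul := hαmul
      involutive := hαα
      map_mem := fun {t d} hd => by
        have h1 := hψ.map_mem (single_mem_matrixGrading (γ := γ) hd i₀ i₀)
        have h2 := matrixGrading_mul_mem h.toIsGroupGrading h1 hu.mem
        rw [hα] at h2
        convert hu.mem_degree h h2 using 2
        group }
  · intro i j
    have h1 := hψ.map_mem (single_one_mem_matrixGrading (γ := γ) h.toIsGroupGrading i i₀)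
    have h2 := matrixGrading_mul_mem h.toIsGroupGrading h1
      (single_one_mem_matrixGrading (γ := γ) h.toIsGroupGrading j i₀)
    rw [hΓ] at h2
    change Γ i j ∈ _
    convert hu.mem_degree h h2 using 2
    group
  · ext j i
    have h1 := congrArg ψ (hΓ i j)
    rw [hψ.map_mul, hψ.involutive, hΓ, hψε] at h1
    have h2 := hu.cancel h h1
    change α (Γ i j) = ε * Γ j i
    rw [h2, ← hεc, ← mul_assoc, hεε, one_mul]
  -- Column j of the inverse is ψ(e_{i₀j})u, the vector dual to e_{j i₀}: ψ(e_{i i₀})ψ(e_{i₀j})u is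
  -- u if i = j and 0 otherwise.
  · have h1 : Matrix.of Γ * Matrix.of (fun k j => (ψ (single i₀ j 1) * u) k i₀) = 1 := by
      ext i j
      refine hu.cancel h ?_
      rw [← hmul]
      have h2 : Matrix.of (fun k j => (ψ (single i₀ j 1) * u) k i₀) * single j i₀ 1 =
          ψ (single i₀ j 1) * u := by
        conv_rhs => rw [← hu.right, ← Matrix.mul_assoc]
        ext a b
        by_cases hb : b = i₀
        · subst hb
          rw [mul_single_apply_same, mul_single_apply_same]
          rfl
        · rw [mul_single_apply_of_ne _ _ _ _ _ hb, mul_single_apply_of_ne _ _ _ _ _ hb]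
      rw [h2, ← Matrix.mul_assoc, ← hψ.map_mul]
      by_cases hij : i = j
      · subst hij
        rw [single_mul_single_same, mul_one, hu.left, one_apply_eq, hu.right]
      · rw [single_mul_single_of_ne _ _ _ _ (Ne.symm hij), hψ.map_zero, one_apply_ne hij,
          single_zero, Matrix.zero_mul, Matrix.mul_zero]
    -- Over a finite-dimensional D a right inverse of a square matrix is two-sided.
    have : IsNoetherianRing D := isNoetherian_of_tower F inferInstance
    exact ⟨_, h1, mul_eq_one_comm.1 h1⟩
  · intro Y
    ext i j
    refine hu.cancel h ?_
    rw [← hmul, ← Matrix.mul_assoc, ← hψ.map_mul, matrix_mul_single_eq_sum Y, hψ.map_sum,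
      Matrix.sum_mul, mul_apply, ← mul_single_sum]
    refine Finset.sum_congr rfl fun k _ => ?_
    rw [hψ.map_mul, Matrix.mul_assoc, hΓ, ← Matrix.mul_assoc, hα, Matrix.mul_assoc,
      single_mul_single_same]
    rfl

end MatrixGrading

/-! ### Gram matrices and homogeneous changes of basis -/

section GramMatrices

open Matrix

variable {F G D : Type*} [Field F] [Group G] [Ring D] [Algebra F D] {𝒟 : G → Submodule F D}
variable {ι κ β : Type*} [Fintype ι] [DecidableEq ι] [Fintype κ] [DecidableEq κ]
  [Fintype β] [DecidableEq β]
variable {g₀ : G} {ψ₀ : D → D} {ε : D}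

theorem IsInvolution.transpose_map_mul (hψ : IsInvolution ψ₀) {ι κ β : Type*} [Fintype κ]
    (A : Matrix ι κ D) (B : Matrix κ β D) :
    (A * B)ᵀ.map ψ₀ = Bᵀ.map ψ₀ * Aᵀ.map ψ₀ := by
  ext i j
  simp only [map_apply, transpose_apply, mul_apply, hψ.map_sum, hψ.map_mul]

theorem IsInvolution.transpose_map_transpose_map (hψ : IsInvolution ψ₀) {ι κ : Type*}
    (A : Matrix ι κ D) : (Aᵀ.map ψ₀)ᵀ.map ψ₀ = A := by
  ext i j
  simp only [map_apply, transpose_apply, hψ.involutive]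

theorem IsInvolution.transpose_map_one (hψ : IsInvolution ψ₀) {ι : Type*} [DecidableEq ι] :
    (1 : Matrix ι ι D)ᵀ.map ψ₀ = 1 := by
  rw [transpose_one, Matrix.map_one _ hψ.map_zero hψ.map_one]

/-- Two Gram matrices are related by a change of homogeneous basis. -/
def GramEquiv (𝒟 : G → Submodule F D) (ψ₀ : D → D) (γ : ι → G) (Γ : Matrix ι ι D) (γ' : κ → G)
    (Γ' : Matrix κ κ D) : Prop :=
  SameDegrees 𝒟 γ γ' ∧ ∃ P Q, IsHomogeneousBaseChange 𝒟 γ γ' P Q ∧ Pᵀ.map ψ₀ * Γ * P = Γ'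

theorem SameDegrees.trans (h : IsGradedDivisionAlgebra 𝒟) {ι κ β : Type*} {γ : ι → G} {γ' : κ → G}
    {γ'' : β → G} (h₁ : SameDegrees 𝒟 γ γ') (h₂ : SameDegrees 𝒟 γ' γ'') : SameDegrees 𝒟 γ γ'' := by
  obtain ⟨e, he⟩ := h₁
  obtain ⟨e', he'⟩ := h₂
  refine ⟨e.trans e', fun i => ?_⟩
  simpa [mul_assoc] using h.mul_mem_support (he i) (he' (e i))

theorem SameDegrees.refl (h : IsGradedDivisionAlgebra 𝒟) {ι : Type*} (γ : ι → G) :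
    SameDegrees 𝒟 γ γ :=
  ⟨.refl _, fun i => by simpa using h.one_mem_support⟩

theorem IsHomogeneousBaseChange.trans (h : IsGroupGrading 𝒟) {γ : ι → G} {γ' : κ → G}
    {γ'' : β → G} {P : Matrix ι κ D} {Q : Matrix κ ι D} {P' : Matrix κ β D} {Q' : Matrix β κ D}
    (h₁ : IsHomogeneousBaseChange 𝒟 γ γ' P Q) (h₂ : IsHomogeneousBaseChange 𝒟 γ' γ'' P' Q') :
    IsHomogeneousBaseChange 𝒟 γ γ'' (P * P') (Q' * Q) where
  mem i j := by
    rw [mul_apply]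
    refine Submodule.sum_mem _ fun k _ => ?_
    simpa [mul_assoc] using h.mul_mem (h₁.mem i k) (h₂.mem k j)
  mul_inv := by rw [Matrix.mul_assoc, ← Matrix.mul_assoc P', h₂.mul_inv, Matrix.one_mul, h₁.mul_inv]
  inv_mul := by rw [Matrix.mul_assoc, ← Matrix.mul_assoc Q, h₁.inv_mul, Matrix.one_mul, h₂.inv_mul]

theorem IsGradedGramMatrix.of_gramEquiv (h : IsGroupGrading 𝒟)
    (hψ : IsTwistedDegreeInvertingInvolution 𝒟 g₀ ψ₀) (hε : ε = 1 ∨ ε = -1) {γ : ι → G}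
    {Γ : Matrix ι ι D} {γ' : κ → G} {Γ' : Matrix κ κ D} (hΓ : IsGradedGramMatrix 𝒟 g₀ ψ₀ ε γ Γ)
    (he : GramEquiv 𝒟 ψ₀ γ Γ γ' Γ') : IsGradedGramMatrix 𝒟 g₀ ψ₀ ε γ' Γ' := by
  obtain ⟨-, P, Q, hPQ, rfl⟩ := he
  refine ⟨fun i j => ?_, ?_, ?_⟩
  · rw [mul_apply]
    refine Submodule.sum_mem _ fun k _ => ?_
    rw [mul_apply, Finset.sum_mul]
    refine Submodule.sum_mem _ fun l _ => ?_
    rw [map_apply, transpose_apply]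
    convert h.mul_mem (h.mul_mem (hψ.map_mem (hPQ.mem l i)) (hΓ.mem l k)) (hPQ.mem k j) using 2
    group
  · rw [hψ.transpose_map_mul, hψ.transpose_map_mul, hψ.transpose_map_transpose_map, hΓ.symm]
    rcases hε with rfl | rfl <;> simp [Matrix.mul_assoc]
  · obtain ⟨N, h1, h2⟩ := hΓ.exists_inv
    have hP : Pᵀ.map ψ₀ * Qᵀ.map ψ₀ = 1 := by
      rw [← hψ.transpose_map_mul, hPQ.inv_mul, hψ.transpose_map_one]
    have hQ : Qᵀ.map ψ₀ * Pᵀ.map ψ₀ = 1 := by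
      rw [← hψ.transpose_map_mul, hPQ.mul_inv, hψ.transpose_map_one]
    refine ⟨Q * N * Qᵀ.map ψ₀, ?_, ?_⟩
    · calc _ = Pᵀ.map ψ₀ * (Γ * ((P * Q) * N)) * Qᵀ.map ψ₀ := by simp only [Matrix.mul_assoc]
        _ = 1 := by rw [hPQ.mul_inv, Matrix.one_mul, h1, Matrix.mul_one, hP]
    · calc _ = Q * (N * ((Qᵀ.map ψ₀ * Pᵀ.map ψ₀) * Γ)) * P := by simp only [Matrix.mul_assoc]
        _ = 1 := by rw [hQ, Matrix.one_mul, h2, Matrix.mul_one, hPQ.inv_mul]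

namespace GramEquiv

theorem trans (h : IsGradedDivisionAlgebra 𝒟) (hψ : IsInvolution ψ₀)
    {γ : ι → G} {Γ : Matrix ι ι D} {γ' : κ → G} {Γ' : Matrix κ κ D} {γ'' : β → G}
    {Γ'' : Matrix β β D} (h₁ : GramEquiv 𝒟 ψ₀ γ Γ γ' Γ') (h₂ : GramEquiv 𝒟 ψ₀ γ' Γ' γ'' Γ'') :
    GramEquiv 𝒟 ψ₀ γ Γ γ'' Γ'' := by
  obtain ⟨hd, P, Q, hPQ, rfl⟩ := h₁
  obtain ⟨hd', P', Q', hPQ', rfl⟩ := h₂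
  refine ⟨hd.trans h hd', _, _, hPQ.trans h.toIsGroupGrading hPQ', ?_⟩
  rw [hψ.transpose_map_mul]
  simp only [Matrix.mul_assoc]

theorem reindex (h : IsGradedDivisionAlgebra 𝒟) (hψ : IsInvolution ψ₀) {γ : ι → G}
    {Γ : Matrix ι ι D} {γ' : κ → G} {Γ' : Matrix κ κ D} (e : κ ≃ ι) (hγ : ∀ i, γ' i = γ (e i))
    (hΓ : ∀ i j, Γ' i j = Γ (e i) (e j)) : GramEquiv 𝒟 ψ₀ γ Γ γ' Γ' := by
  obtain rfl : γ' = γ ∘ e := funext hγ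
  obtain rfl : Γ' = Γ.submatrix e e := Matrix.ext hΓ
  refine ⟨⟨e.symm, fun i => by simpa using h.one_mem_support⟩,
    (1 : Matrix ι ι D).submatrix id e, (1 : Matrix ι ι D).submatrix e id,
    ⟨fun i j => ?_, ?_, ?_⟩, ?_⟩
  · rw [submatrix_apply, id, one_apply]
    split_ifs with hij
    · subst hij; simpa using h.one_mem
    · exact zero_mem _
  · rw [submatrix_mul_equiv, Matrix.mul_one]; rfl
  · rw [← submatrix_mul _ _ e id e Function.bijective_id, Matrix.mul_one, submatrix_one_equiv]
  · ext i j
    simp [mul_apply, one_apply, apply_ite ψ₀, hψ.map_one, hψ.map_zero]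

theorem rescale (h : IsGradedDivisionAlgebra 𝒟) (hψ : IsInvolution ψ₀) (γ : ι → G)
    (Γ : Matrix ι ι D) (t : ι → G) (c : ι → D) (hc : ∀ i, c i ∈ 𝒟 (t i)) (hc0 : ∀ i, c i ≠ 0) :
    GramEquiv 𝒟 ψ₀ γ Γ (fun i => γ i * t i) (Matrix.of fun i j => ψ₀ (c i) * Γ i j * c j) := by
  choose y hy h1 h2 using fun i => h.exists_inv (hc i) (hc0 i)
  refine ⟨⟨.refl _, fun i => ?_⟩, diagonal c, diagonal y, ⟨fun i j => ?_, ?_, ?_⟩, ?_⟩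
  · simpa using mem_gradedSupport.2 ⟨c i, hc i, hc0 i⟩
  · rw [diagonal_apply]
    split_ifs with hij
    · subst hij; simpa using hc i
    · exact zero_mem _
  · rw [diagonal_mul_diagonal, funext h1, diagonal_one]
  · rw [diagonal_mul_diagonal, funext h2, diagonal_one]
  · ext i j
    rw [mul_diagonal, diagonal_transpose, diagonal_map hψ.map_zero, diagonal_mul]
    rfl

theorem fromBlocks (h : IsGradedDivisionAlgebra 𝒟) (hψ : IsInvolution ψ₀) (a : β → G)
    (A : Matrix β β D) {γ : ι → G} {Γ : Matrix ι ι D} {γ' : κ → G} {Γ' : Matrix κ κ D}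
    (he : GramEquiv 𝒟 ψ₀ γ Γ γ' Γ') :
    GramEquiv 𝒟 ψ₀ (Sum.elim a γ) (fromBlocks A 0 0 Γ) (Sum.elim a γ') (fromBlocks A 0 0 Γ') := by
  obtain ⟨⟨e, hs⟩, P, Q, hPQ, rfl⟩ := he
  refine ⟨⟨(Equiv.refl β).sumCongr e, ?_⟩, Matrix.fromBlocks 1 0 0 P, Matrix.fromBlocks 1 0 0 Q,
    ⟨?_, ?_, ?_⟩, ?_⟩
  · rintro (i | i)
    · simpa using h.one_mem_support
    · simpa using hs i
  · rintro (i | i) (j | j)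
    · rw [fromBlocks_apply₁₁, one_apply]
      split_ifs with hij
      · subst hij; simpa using h.one_mem
      · exact zero_mem _
    · exact zero_mem _
    · exact zero_mem _
    · exact hPQ.mem i j
  · simp [fromBlocks_multiply, hPQ.mul_inv]
  · simp [fromBlocks_multiply, hPQ.inv_mul]
  · simp [fromBlocks_transpose, fromBlocks_map, fromBlocks_multiply, hψ.map_zero, hψ.map_one]

/-- Splitting off a block with a homogeneous inverse. -/
theorem exists_fromBlocks (h : IsGradedDivisionAlgebra 𝒟)
    (hψ : IsTwistedDegreeInvertingInvolution 𝒟 g₀ ψ₀) (hε : ε = 1 ∨ ε = -1) {γ : β ⊕ ι → G}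
    {Γ : Matrix (β ⊕ ι) (β ⊕ ι) D} (hΓ : IsGradedGramMatrix 𝒟 g₀ ψ₀ ε γ Γ) {A' : Matrix β β D}
    (hA : Γ.toBlocks₁₁ * A' = 1)
    (hA' : ∀ i j, A' i j ∈ 𝒟 ((γ (.inl i))⁻¹ * γ (.inl j) * g₀)) :
    ∃ E, GramEquiv 𝒟 ψ₀ γ Γ γ (Matrix.fromBlocks Γ.toBlocks₁₁ 0 0 E) := by
  set X := A' * Γ.toBlocks₁₂ with hX
  set E := Γ.toBlocks₂₂ - Γ.toBlocks₂₁ * X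
  have hP : IsHomogeneousBaseChange 𝒟 γ γ (Matrix.fromBlocks 1 (-X) 0 1)
      (Matrix.fromBlocks 1 X 0 1) := by
    refine ⟨?_, by simp [fromBlocks_multiply], by simp [fromBlocks_multiply]⟩
    rintro (i | i) (j | j)
    · rw [fromBlocks_apply₁₁, one_apply]
      split_ifs with hij
      · subst hij; simpa using h.one_mem
      · exact zero_mem _
    · rw [fromBlocks_apply₁₂, Matrix.neg_apply, hX, mul_apply]
      refine neg_mem (Submodule.sum_mem _ fun k _ => ?_)
      change A' i k * Γ (.inl k) (.inr j) ∈ _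
      convert h.mul_mem (hA' i k) (hΓ.mem (.inl k) (.inr j)) using 2
      group
    · exact zero_mem _
    · rw [fromBlocks_apply₂₂, one_apply]
      split_ifs with hij
      · subst hij; simpa using h.one_mem
      · exact zero_mem _
  obtain ⟨Z, hZ⟩ : ∃ Z, (Matrix.fromBlocks 1 (-X) 0 1)ᵀ.map ψ₀ * Γ * Matrix.fromBlocks 1 (-X) 0 1 =
      Matrix.fromBlocks Γ.toBlocks₁₁ 0 Z E := by
    refine ⟨(-X)ᵀ.map ψ₀ * Γ.toBlocks₁₁ + Γ.toBlocks₂₁, ?_⟩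
    have hBX : Γ.toBlocks₁₁ * X = Γ.toBlocks₁₂ := by
      rw [hX, ← Matrix.mul_assoc, hA, Matrix.one_mul]
    conv_lhs => rw [← fromBlocks_toBlocks Γ]
    rw [Matrix.mul_assoc, fromBlocks_multiply, fromBlocks_transpose, fromBlocks_map,
      fromBlocks_multiply]
    simp [hψ.map_zero, hψ.map_one, hBX, E, sub_eq_neg_add]
  have hG : GramEquiv 𝒟 ψ₀ γ Γ γ (Matrix.fromBlocks Γ.toBlocks₁₁ 0 Z E) :=
    ⟨SameDegrees.refl h γ, _, _, hP, hZ⟩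
  have hsymm := (hΓ.of_gramEquiv h.toIsGroupGrading hψ hε hG).symm
  -- The base change clears only the upper right block; (skew-)symmetry then clears the lower left
  -- one.
  have hZ0 : Z = 0 := by
    ext i j
    have := congrFun (congrFun hsymm (.inr i)) (.inl j)
    simp only [map_apply, transpose_apply, fromBlocks_apply₁₂, Matrix.zero_apply, hψ.map_zero,
      Matrix.smul_apply, fromBlocks_apply₂₁, smul_eq_mul] at this
    rcases hε with rfl | rfl <;> simpa [eq_comm] using this
  exact ⟨E, hZ0 ▸ hG⟩

end GramEquiv

theorem IsGradedGramMatrix.of_fromBlocks {a : β → G} {A : Matrix β β D} {γ : ι → G}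
    {E : Matrix ι ι D}
    (hΓ : IsGradedGramMatrix 𝒟 g₀ ψ₀ ε (Sum.elim a γ) (Matrix.fromBlocks A 0 0 E)) :
    IsGradedGramMatrix 𝒟 g₀ ψ₀ ε γ E := by
  refine ⟨fun i j => hΓ.mem (.inr i) (.inr j), ?_, ?_⟩
  · ext i j
    exact congrFun (congrFun hΓ.symm (.inr i)) (.inr j)
  · obtain ⟨N, h1, h2⟩ := hΓ.exists_inv
    refine ⟨N.toBlocks₂₂, ?_, ?_⟩
    · rw [← fromBlocks_toBlocks N, fromBlocks_multiply, ← fromBlocks_one] at h1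
      simpa using (fromBlocks_inj.1 h1).2.2.2
    · rw [← fromBlocks_toBlocks N, fromBlocks_multiply, ← fromBlocks_one] at h2
      simpa using (fromBlocks_inj.1 h2).2.2.2

end GramMatrices

/-! ### Reduction to lines and hyperbolic planes -/

section CanonicalForm

open Matrix

variable {F G D : Type*} [Field F] [Group G] [Ring D] [Algebra F D] {𝒟 : G → Submodule F D}
variable {g₀ : G} {ψ₀ : D → D} {ε : D}

/-- The orthogonal sum of `μ` copies of the form `(1)` and of `κ` hyperbolic planes. -/
def hyperbolicForm (ε : D) (μ κ : Type*) [DecidableEq μ] [DecidableEq κ] :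
    Matrix (μ ⊕ (κ ⊕ κ)) (μ ⊕ (κ ⊕ κ)) D :=
  Matrix.fromBlocks 1 0 0 (Matrix.fromBlocks 0 1 (diagonal fun _ => ε) 0)

/-- The family of degrees `(g, g', g' g₀)`. -/
def pairedFamily {μ κ : Type*} (g₀ : G) (g : μ → G) (g' : κ → G) : μ ⊕ (κ ⊕ κ) → G :=
  Sum.elim g (Sum.elim g' fun j => g' j * g₀)

/-- A Gram matrix that can be brought to the form `hyperbolicForm`; copies of `(1)` occur only if
`g₀ = 1` and `ε = 1`. -/
def HasHyperbolicForm {ι : Type*} [Fintype ι] [DecidableEq ι] (𝒟 : G → Submodule F D) (g₀ : G)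
    (ψ₀ : D → D) (ε : D) (γ : ι → G) (Γ : Matrix ι ι D) : Prop :=
  ∃ (m k : ℕ) (g : Fin m → G) (g' : Fin k → G), (0 < m → g₀ = 1 ∧ ε = 1) ∧
    GramEquiv 𝒟 ψ₀ γ Γ (pairedFamily g₀ g g') (hyperbolicForm ε (Fin m) (Fin k))

namespace HasHyperbolicForm

theorem of_gramEquiv (h : IsGradedDivisionAlgebra 𝒟) (hψ : IsInvolution ψ₀)
    {ι κ : Type*} [Fintype ι] [DecidableEq ι] [Fintype κ] [DecidableEq κ] {γ : ι → G}
    {Γ : Matrix ι ι D} {γ' : κ → G} {Γ' : Matrix κ κ D} (he : GramEquiv 𝒟 ψ₀ γ Γ γ' Γ')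
    (hf : HasHyperbolicForm 𝒟 g₀ ψ₀ ε γ' Γ') : HasHyperbolicForm 𝒟 g₀ ψ₀ ε γ Γ := by
  obtain ⟨m, k, g, g', hm, hg⟩ := hf
  exact ⟨m, k, g, g', hm, he.trans h hψ hg⟩

/-- Arbitrary finite index types let the induction add summands through `Sum`, without arithmetic in
`Fin`. -/
theorem of_fintype (h : IsGradedDivisionAlgebra 𝒟) (hψ : IsInvolution ψ₀)
    {ι μ κ : Type*} [Fintype ι] [DecidableEq ι] [Fintype μ] [DecidableEq μ] [Fintype κ]
    [DecidableEq κ] {γ : ι → G} {Γ : Matrix ι ι D} {g : μ → G} {g' : κ → G}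
    (hμ : Nonempty μ → g₀ = 1 ∧ ε = 1)
    (he : GramEquiv 𝒟 ψ₀ γ Γ (pairedFamily g₀ g g') (hyperbolicForm ε μ κ)) :
    HasHyperbolicForm 𝒟 g₀ ψ₀ ε γ Γ := by
  let eμ := (Fintype.equivFin μ).symm
  let eκ := (Fintype.equivFin κ).symm
  refine ⟨_, _, g ∘ eμ, g' ∘ eκ, fun hm => hμ (Fintype.card_pos_iff.1 hm), he.trans h hψ ?_⟩
  refine GramEquiv.reindex h hψ (eμ.sumCongr (eκ.sumCongr eκ)) ?_ ?_
  · rintro (i | i | i) <;> rfl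
  · rintro (i | i | i) (j | j | j) <;>
      simp [hyperbolicForm, one_apply, diagonal_apply]

theorem sum_one (h : IsGradedDivisionAlgebra 𝒟) (hψ : IsInvolution ψ₀)
    {ι : Type*} [Fintype ι] [DecidableEq ι] {γ : ι → G} {Γ : Matrix ι ι D} (a : Unit → G)
    (hg₀ : g₀ = 1) (hε : ε = 1) (hf : HasHyperbolicForm 𝒟 g₀ ψ₀ ε γ Γ) :
    HasHyperbolicForm 𝒟 g₀ ψ₀ ε (Sum.elim a γ) (Matrix.fromBlocks 1 0 0 Γ) := by
  obtain ⟨m, k, g, g', hm, hg⟩ := hf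
  refine of_fintype h hψ (μ := Unit ⊕ Fin m) (κ := Fin k) (g := Sum.elim a g) (g' := g')
    (fun _ => ⟨hg₀, hε⟩) ((hg.fromBlocks h hψ a 1).trans h hψ ?_)
  refine GramEquiv.reindex h hψ (Equiv.sumAssoc _ _ _) ?_ ?_
  · rintro ((i | i) | i | i) <;> rfl
  · rintro ((i | i) | i | i) ((j | j) | j | j) <;>
      simp [hyperbolicForm, one_apply, diagonal_apply]

/-- The equivalence `(1 ⊕ 1) ⊕ (μ ⊕ (κ ⊕ κ)) ≃ μ ⊕ ((1 ⊕ κ) ⊕ (1 ⊕ κ))`. -/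
def sumPairEquiv (μ κ : Type*) :
    μ ⊕ ((Unit ⊕ κ) ⊕ (Unit ⊕ κ)) ≃ (Unit ⊕ Unit) ⊕ (μ ⊕ (κ ⊕ κ)) where
  toFun := Sum.elim (fun i => .inr (.inl i)) (Sum.elim
    (Sum.elim (fun i => .inl (.inl i)) fun i => .inr (.inr (.inl i)))
    (Sum.elim (fun i => .inl (.inr i)) fun i => .inr (.inr (.inr i))))
  invFun := Sum.elim (Sum.elim (fun i => .inr (.inl (.inl i))) fun i => .inr (.inr (.inl i)))
    (Sum.elim (fun i => .inl i) (Sum.elim (fun i => .inr (.inl (.inr i)))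
      fun i => .inr (.inr (.inr i))))
  left_inv := by rintro (i | (i | i) | (i | i)) <;> rfl
  right_inv := by rintro ((i | i) | i | i | i) <;> rfl

theorem sum_plane (h : IsGradedDivisionAlgebra 𝒟) (hψ : IsInvolution ψ₀)
    {ι : Type*} [Fintype ι] [DecidableEq ι] {γ : ι → G} {Γ : Matrix ι ι D} (a : Unit ⊕ Unit → G)
    (ha : a (.inr ()) = a (.inl ()) * g₀) (hf : HasHyperbolicForm 𝒟 g₀ ψ₀ ε γ Γ) :
    HasHyperbolicForm 𝒟 g₀ ψ₀ ε (Sum.elim a γ)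
      (Matrix.fromBlocks (Matrix.fromBlocks 0 1 (diagonal fun _ => ε) 0) 0 0 Γ) := by
  obtain ⟨m, k, g, g', hm, hg⟩ := hf
  refine of_fintype h hψ (μ := Fin m) (κ := Unit ⊕ Fin k) (g := g)
    (g' := Sum.elim (fun _ => a (.inl ())) g')
    (fun ⟨i⟩ => hm (Nat.zero_lt_of_lt i.2)) ((hg.fromBlocks h hψ a _).trans h hψ ?_)
  refine GramEquiv.reindex h hψ (sumPairEquiv _ _) ?_ ?_
  · rintro (i | (i | i) | (i | i)) <;> first | rfl | exact ha.symm
  · rintro (i | (i | i) | (i | i)) (j | (j | j) | (j | j)) <;>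
      simp [hyperbolicForm, sumPairEquiv, one_apply, diagonal_apply]

end HasHyperbolicForm

/-- The index set of a matrix, split along an injection. -/
noncomputable def splitEquiv {β ι : Type*} (f : β → ι) (hf : Function.Injective f)
    [DecidablePred (· ∈ Set.range f)] :
    β ⊕ {j // j ∉ Set.range f} ≃ ι :=
  ((Equiv.ofInjective f hf).sumCongr (Equiv.refl _)).trans (Equiv.sumCompl (· ∈ Set.range f))

theorem exists_split {β ι : Type*} [Fintype β] [DecidableEq β] [Fintype ι] [DecidableEq ι]
    (h : IsGradedDivisionAlgebra 𝒟)
    (hψ : IsTwistedDegreeInvertingInvolution 𝒟 g₀ ψ₀) (hε : ε = 1 ∨ ε = -1) {γ : ι → G}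
    {Γ : Matrix ι ι D} (hΓ : IsGradedGramMatrix 𝒟 g₀ ψ₀ ε γ Γ) (f : β → ι)
    (hf : Function.Injective f) {A' : Matrix β β D} (hA : Γ.submatrix f f * A' = 1)
    (hA' : ∀ i j, A' i j ∈ 𝒟 ((γ (f i))⁻¹ * γ (f j) * g₀)) :
    ∃ (n : ℕ) (a : Fin n → G) (E : Matrix (Fin n) (Fin n) D),
      n + Fintype.card β = Fintype.card ι ∧ IsGradedGramMatrix 𝒟 g₀ ψ₀ ε a E ∧
      GramEquiv 𝒟 ψ₀ γ Γ (Sum.elim (γ ∘ f) a) (Matrix.fromBlocks (Γ.submatrix f f) 0 0 E) := by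
  classical
  let c := Fintype.equivFin {j // j ∉ Set.range f}
  let e : β ⊕ Fin _ ≃ ι := ((Equiv.refl β).sumCongr c.symm).trans (splitEquiv f hf)
  have h1 := GramEquiv.reindex h hψ.toIsInvolution (γ := γ) (Γ := Γ) (γ' := γ ∘ e)
    (Γ' := Γ.submatrix e e) e (fun _ => rfl) (fun _ _ => rfl)
  have hΓ1 := hΓ.of_gramEquiv h.toIsGroupGrading hψ hε h1
  obtain ⟨E, hE⟩ := GramEquiv.exists_fromBlocks h hψ hε hΓ1 (A' := A') hA hA'
  have hγ : γ ∘ e = Sum.elim (γ ∘ f) (γ ∘ e ∘ Sum.inr) := by ext (i | i) <;> rfl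
  have h2 := h1.trans h hψ.toIsInvolution hE
  have hΓ2 := hΓ.of_gramEquiv h.toIsGroupGrading hψ hε h2
  rw [hγ] at h2 hΓ2
  refine ⟨_, _, E, ?_, hΓ2.of_fromBlocks, h2⟩
  rw [← Fintype.card_congr e, Fintype.card_sum, Fintype.card_fin, add_comm]

variable [IsAlgClosed F] [FiniteDimensional F D]

/-- Every homogeneous hermitian or skew-hermitian Gram matrix is equivalent to an orthogonal sum of
forms `(1)` and hyperbolic planes. -/
theorem IsGradedGramMatrix.hasHyperbolicForm (h : IsGradedDivisionAlgebra 𝒟)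
    (hψ : IsTwistedDegreeInvertingInvolution 𝒟 g₀ ψ₀) (hε : ε = 1 ∨ ε = -1) (hg₀ : g₀ * g₀ = 1)
    (hT : g₀ ∈ gradedSupport 𝒟 → g₀ = 1) {n : ℕ} {γ : Fin n → G} {Γ : Matrix (Fin n) (Fin n) D}
    (hΓ : IsGradedGramMatrix 𝒟 g₀ ψ₀ ε γ Γ) : HasHyperbolicForm 𝒟 g₀ ψ₀ ε γ Γ := by
  induction n using Nat.strong_induction_on with
  | _ n ih =>
  have := h.nontrivial
  have hεε : ε * ε = 1 := by rcases hε with rfl | rfl <;> simp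
  have hsymm : ∀ i j, ψ₀ (Γ j i) = ε * Γ i j := fun i j => congrFun (congrFun hΓ.symm i) j
  by_cases hdiag : ∃ i, Γ i i ≠ 0
  · obtain ⟨i, hi⟩ := hdiag
    have hmem := hΓ.mem i i
    rw [mul_assoc, inv_mul_cancel, mul_one] at hmem
    have hg1 : g₀ = 1 := hT (by
      have := h.inv_mem_support (mem_gradedSupport.2 ⟨_, hmem, hi⟩)
      rwa [inv_inv] at this)
    rw [hg1, inv_one] at hmem
    obtain ⟨c, hc⟩ := h.exists_algebraMap_eq hmem
    have hc0 : c ≠ 0 := by rintro rfl; exact hi (by rw [← hc, map_zero])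
    -- ψ₀ fixes scalars, so a nonzero scalar on the diagonal rules out a sign.
    have hε1 : ε = 1 := by
      have h1 := hsymm i i
      rw [← hc, hψ.map_algebraMap] at h1
      have hu : IsUnit (algebraMap F D c) := (IsUnit.mk0 c hc0).map _
      exact hu.mul_right_cancel (by rw [← h1, one_mul])
    obtain ⟨s, hs⟩ := IsAlgClosed.exists_eq_mul_self c
    have hs0 : s ≠ 0 := by rintro rfl; simp at hs; exact hc0 hs
    set y : Fin n → D := fun j => if j = i then algebraMap F D s⁻¹ else 1 with hy
    have hres := GramEquiv.rescale h hψ.toIsInvolution γ Γ (fun _ => 1) y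
      (fun j => by
        rw [hy]; dsimp only; split_ifs
        · exact h.algebraMap_mem _
        · exact h.one_mem)
      (fun j => by
        rw [hy]; dsimp only; split_ifs
        · exact ((IsUnit.mk0 _ (inv_ne_zero hs0)).map (algebraMap F D)).ne_zero
        · exact h.one_ne_zero)
    have hΓ1 := hΓ.of_gramEquiv h.toIsGroupGrading hψ hε hres
    refine .of_gramEquiv h hψ.toIsInvolution hres ?_
    set Γ₁ := Matrix.of fun i j => ψ₀ (y i) * Γ i j * y j with hΓ₁
    have hA : Γ₁.submatrix (fun _ : Unit => i) (fun _ : Unit => i) = 1 := by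
      ext a b
      simp only [hΓ₁, submatrix_apply, of_apply, hy, if_true, hψ.map_algebraMap, ← hc, ← map_mul]
      rw [hs, show s⁻¹ * (s * s) * s⁻¹ = 1 by field_simp, map_one]
      rfl
    obtain ⟨k, a, E, hk, hE, hG⟩ := exists_split h hψ hε hΓ1 (fun _ : Unit => i)
      (fun _ _ _ => rfl) (A' := (1 : Matrix Unit Unit D)) (by rw [hA, Matrix.mul_one])
      (fun a b => by
        rw [Subsingleton.elim a b, one_apply_eq, inv_mul_cancel, one_mul, hg1]
        exact h.one_mem)
    rw [hA] at hG
    have hk' : k < n := by simp at hk; omega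
    exact .of_gramEquiv h hψ.toIsInvolution hG
      (.sum_one h hψ.toIsInvolution _ hg1 hε1 (ih k hk' hE))
  · push Not at hdiag
    rcases Nat.eq_zero_or_pos n with rfl | hn
    · refine .of_fintype h hψ.toIsInvolution (μ := Fin 0) (κ := Fin 0) (g := Fin.elim0)
        (g' := Fin.elim0) (fun ⟨i⟩ => i.elim0) ?_
      exact GramEquiv.reindex h hψ.toIsInvolution
        (Equiv.equivOfIsEmpty (Fin 0 ⊕ (Fin 0 ⊕ Fin 0)) (Fin 0)) isEmptyElim isEmptyElim
    let i : Fin n := ⟨0, hn⟩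
    obtain ⟨j, hj⟩ : ∃ j, Γ i j ≠ 0 := by
      by_contra! h0
      obtain ⟨N, hN, -⟩ := hΓ.exists_inv
      have := congrFun (congrFun hN i) i
      rw [mul_apply, one_apply_eq, Finset.sum_eq_zero fun k _ => by rw [h0, zero_mul]] at this
      exact h.one_ne_zero this.symm
    have hij : i ≠ j := by
      intro hij
      rw [← hij] at hj
      exact hj (hdiag i)
    obtain ⟨z, hz, hz1, hz2⟩ := h.exists_inv (hΓ.mem i j) hj
    have hz0 : z ≠ 0 := by rintro rfl; rw [mul_zero] at hz1; exact h.one_ne_zero hz1.symm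
    set y : Fin n → D := fun k => if k = j then z else 1 with hy
    -- Dividing basis vector j by Γ i j makes that entry 1 and moves the degree of the vector to γ_i
    -- g₀.
    set t : Fin n → G := fun k => if k = j then (g₀⁻¹ * (γ i)⁻¹ * γ j)⁻¹ else 1 with ht
    have hres := GramEquiv.rescale h hψ.toIsInvolution γ Γ t y
      (fun k => by
        rw [hy, ht]; dsimp only; split_ifs
        · exact hz
        · exact h.one_mem)
      (fun k => by
        rw [hy]; dsimp only; split_ifs
        · exact hz0
        · exact h.one_ne_zero)
    have hΓ1 := hΓ.of_gramEquiv h.toIsGroupGrading hψ hε hres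
    refine .of_gramEquiv h hψ.toIsInvolution hres ?_
    set Γ₁ := Matrix.of fun i j => ψ₀ (y i) * Γ i j * y j with hΓ₁
    have hyi : y i = 1 := if_neg hij
    have hyj : y j = z := if_pos rfl
    have h01 : Γ₁ i j = 1 := by simp [hΓ₁, hyi, hyj, hψ.map_one, hz1]
    have h10 : Γ₁ j i = ε := by
      have h2 := congrFun (congrFun hΓ1.symm j) i
      simp only [map_apply, transpose_apply, h01, hψ.map_one, Matrix.smul_apply, smul_eq_mul] at h2
      rw [← one_mul (Γ₁ j i), ← hεε, mul_assoc, ← h2, mul_one]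
    have h00 : Γ₁ i i = 0 := by simp [hΓ₁, hdiag]
    have h11 : Γ₁ j j = 0 := by simp [hΓ₁, hdiag]
    let f : Unit ⊕ Unit → Fin n := Sum.elim (fun _ => i) (fun _ => j)
    have hf : Function.Injective f := by
      rintro (a | a) (b | b) hab
      · rfl
      · exact absurd hab hij
      · exact absurd hab.symm hij
      · rfl
    have hti : γ i * t i = γ i := by rw [ht]; dsimp only; rw [if_neg hij, mul_one]
    have htj : γ j * t j = γ i * g₀ := by rw [ht]; dsimp only; rw [if_pos rfl]; group
    have hA : Γ₁.submatrix f f = Matrix.fromBlocks 0 1 (diagonal fun _ => ε) 0 := by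
      ext (a | a) (b | b)
      · exact h00
      · exact h01
      · change Γ₁ j i = (diagonal fun _ : Unit => ε) a b
        rw [h10, Subsingleton.elim a b, diagonal_apply_eq]
      · exact h11
    obtain ⟨k, a, E, hk, hE, hG⟩ := exists_split h hψ hε hΓ1 f hf
      -- This is the inverse of the hyperbolic plane, as ε² = 1; its homogeneity uses g₀² = 1.
      (A' := Matrix.fromBlocks 0 (diagonal fun _ => ε) 1 0)
      (by rw [hA, fromBlocks_multiply]; simp [hεε]) (by
        have hεm : ε ∈ 𝒟 1 := by
          rcases hε with rfl | rfl
          · exact h.one_mem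
          · exact neg_mem h.one_mem
        rintro (a | a) (b | b)
        · exact zero_mem _
        · change (diagonal fun _ => ε) a b ∈ 𝒟 ((γ i * t i)⁻¹ * (γ j * t j) * g₀)
          rw [Subsingleton.elim a b, diagonal_apply_eq, hti, htj, inv_mul_cancel_left, hg₀]
          exact hεm
        · change (1 : Matrix Unit Unit D) a b ∈ 𝒟 ((γ j * t j)⁻¹ * (γ i * t i) * g₀)
          rw [Subsingleton.elim a b, one_apply_eq, hti, htj, mul_assoc, inv_mul_cancel]
          exact h.one_mem
        · exact zero_mem _)
    rw [hA] at hG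
    have hk' : k < n := by simp at hk; omega
    exact .of_gramEquiv h hψ.toIsInvolution hG
      (.sum_plane h hψ.toIsInvolution _ (htj.trans (by rw [← hti]; rfl)) (ih k hk' hE))

end CanonicalForm

/-! ### Constructing involutions and normalizing Φ -/

section Involutions

open Matrix

variable {F G D : Type*} [Field F] [Group G] [Ring D] [Algebra F D] {𝒟 : G → Submodule F D}
variable {l : ℕ}

theorem exists_algebraMap_eq_of_mem_center_matrix {ι : Type*} [Fintype ι] [DecidableEq ι]
    (e : D ≃ₐ[F] Matrix (Fin l) (Fin l) F) {z : Matrix ι ι D}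
    (hz : z ∈ Subring.center (Matrix ι ι D)) : ∃ c : F, algebraMap F (Matrix ι ι D) c = z := by
  have hz' : z ∈ Set.center (Matrix ι ι D) := hz
  rw [center_eq_scalar_image] at hz'
  obtain ⟨d, hd, rfl⟩ := hz'
  obtain ⟨c, rfl⟩ := exists_algebraMap_eq_of_mem_center e (z := d) hd
  exact ⟨c, rfl⟩

namespace IsGradedDivisionAlgebra

/-- A degree-inverting anti-automorphism of a graded division algebra with one-dimensional
components is an involution. -/
theorem involutive_of_map_mem_inv [IsAlgClosed F] [FiniteDimensional F D]
    (h : IsGradedDivisionAlgebra 𝒟) {α : D →ₗ[F] D} (h1 : α 1 = 1)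
    (hmul : ∀ a b, α (a * b) = α b * α a) (hα : ∀ t, ∀ d ∈ 𝒟 t, α d ∈ 𝒟 t⁻¹) (d : D) :
    α (α d) = d := by
  induction d using h.induction with
  | add a b ha hb => rw [map_add, map_add, ha, hb]
  | mem t d hd =>
    by_cases hd0 : d = 0
    · simp [hd0]
    obtain ⟨y, hy, hdy, hyd⟩ := h.exists_inv hd hd0
    have hy0 : y ≠ 0 := by rintro rfl; rw [mul_zero] at hdy; exact h.one_ne_zero hdy.symm
    obtain ⟨c, hc⟩ := h.exists_smul_eq hy hy0 (hα t d hd)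
    -- Here y = d⁻¹ and α(d) = cy, so α(α(d))y = α(y)(cy) = α(y)α(d) = α(dy) = 1.
    have h2 : α (α d) * y = 1 := by
      rw [hc, map_smul, smul_mul_assoc, ← mul_smul_comm, ← hc, ← hmul, hdy, h1]
    rw [← mul_one (α (α d)), ← hyd, ← mul_assoc, h2, one_mul]

theorem exists_isDegreeInvertingInvolution [IsAlgClosed F] (h : IsGradedDivisionAlgebra 𝒟)
    (e : D ≃ₐ[F] Matrix (Fin l) (Fin l) F) {g₀ : G} {ψ₀ : D → D}
    (hψ : IsTwistedDegreeInvertingInvolution 𝒟 g₀ ψ₀) (hg₀ : g₀ ∈ gradedSupport 𝒟) :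
    ∃ ψ₁ : D → D, IsDegreeInvertingInvolution 𝒟 ψ₁ := by
  have : FiniteDimensional F D := e.symm.toLinearEquiv.finiteDimensional
  obtain ⟨x, hx, hx0⟩ := mem_gradedSupport.1 hg₀
  obtain ⟨y, hy, hxy, hyx⟩ := h.exists_inv hx hx0
  -- Conjugation by x ∈ D_{g₀} turns the degree g₀⁻¹t⁻¹g₀ into t⁻¹. That the result is still
  -- involutive follows from `involutive_of_map_mem_inv`.
  let α : D →ₗ[F] D :=
    { toFun := fun d => x * ψ₀ d * y
      map_add' := fun a b => by rw [hψ.map_add, mul_add, add_mul]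
      map_smul' := fun c a => by
        rw [hψ.map_smul, mul_smul_comm, smul_mul_assoc, RingHom.id_apply] }
  have hα : ∀ d, α d = x * ψ₀ d * y := fun _ => rfl
  have h1 : α 1 = 1 := by rw [hα, hψ.map_one, mul_one, hxy]
  have hmul : ∀ a b, α (a * b) = α b * α a := fun a b => by
    rw [hα, hα, hα, hψ.map_mul]
    calc x * (ψ₀ b * ψ₀ a) * y = x * ψ₀ b * 1 * ψ₀ a * y := by simp only [mul_one, mul_assoc]
      _ = _ := by rw [← hyx]; simp only [mul_assoc]
  have hdeg : ∀ t, ∀ d ∈ 𝒟 t, α d ∈ 𝒟 t⁻¹ := fun t d hd => by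
    rw [hα]
    convert h.mul_mem (h.mul_mem hx (hψ.map_mem hd)) hy using 2
    group
  exact ⟨α, { map_add := map_add α
              map_center_mul := fun z hz a => by
                obtain ⟨c, rfl⟩ := exists_algebraMap_eq_of_mem_center e hz
                rw [← Algebra.smul_def, map_smul, Algebra.smul_def]
              map_mul := hmul
              involutive := h.involutive_of_map_mem_inv h1 hmul hdeg
              map_mem := fun {g a} ha => hdeg g a ha }⟩

/-- The involution of `M_ι(D)` attached to a monomial hermitian form. -/
theorem exists_matrix_involution {ι : Type*} [Fintype ι] [DecidableEq ι]
    (h : IsGradedDivisionAlgebra 𝒟) (e : D ≃ₐ[F] Matrix (Fin l) (Fin l) F) {g₀ : G} {ψ₀ : D → D}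
    (hψ : IsTwistedDegreeInvertingInvolution 𝒟 g₀ ψ₀) {γ δ : ι → G}
    (hδ : ∀ i, (γ i)⁻¹ * δ i ∈ gradedSupport 𝒟) (ρ : ι → ι) (hρ : Function.Involutive ρ)
    (hρδ : ∀ i, δ (ρ i) * g₀ = δ i) :
    ∃ ψ, IsDegreeInvertingInvolution (matrixGrading 𝒟 γ) ψ := by
  choose c hc hc0 using fun i => mem_gradedSupport.1 (hδ i)
  choose y hy hcy hyc using fun i => h.exists_inv (hc i) (hc0 i)
  -- Rescaling by c passes from degrees γ to δ; there the involution is the ψ₀-transpose with rows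
  -- and columns permuted by ρ, and rescaling back returns to γ.
  refine ⟨fun Y => of fun i j => c i * ψ₀ (y (ρ j) * Y (ρ j) (ρ i) * c (ρ i)) * y j,
    ⟨?_, ?_, ?_, ?_⟩, ?_⟩
  · intro A B
    ext i j
    simp only [of_apply, Matrix.add_apply, mul_add, add_mul, hψ.map_add]
  · intro z hz A
    obtain ⟨a, rfl⟩ := exists_algebraMap_eq_of_mem_center_matrix e hz
    ext i j
    simp only [← Algebra.smul_def, of_apply, Matrix.smul_apply, mul_smul_comm, smul_mul_assoc,
      hψ.map_smul]
  · intro A B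
    ext i j
    simp only [of_apply, mul_apply]
    calc _ = ∑ k, c i * ψ₀ (y (ρ j) * (A (ρ j) k * B k (ρ i)) * c (ρ i)) * y j := by
          rw [Finset.mul_sum, Finset.sum_mul, hψ.map_sum, Finset.mul_sum, Finset.sum_mul]
      _ = ∑ k, c i * ψ₀ (y (ρ j) * (A (ρ j) (ρ k) * B (ρ k) (ρ i)) * c (ρ i)) * y j :=
          (Equiv.sum_comp hρ.toPerm fun k =>
            c i * ψ₀ (y (ρ j) * (A (ρ j) k * B k (ρ i)) * c (ρ i)) * y j).symm
      _ = _ := Finset.sum_congr rfl fun k _ => by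
          have h1 : y (ρ j) * (A (ρ j) (ρ k) * B (ρ k) (ρ i)) * c (ρ i) =
              (y (ρ j) * A (ρ j) (ρ k) * c (ρ k)) * (y (ρ k) * B (ρ k) (ρ i) * c (ρ i)) := by
            calc _ = y (ρ j) * A (ρ j) (ρ k) * 1 * B (ρ k) (ρ i) * c (ρ i) := by
                  simp only [mul_one, mul_assoc]
              _ = _ := by rw [← hcy (ρ k)]; simp only [mul_assoc]
          rw [h1, hψ.map_mul]
          generalize ψ₀ (y (ρ j) * A (ρ j) (ρ k) * c (ρ k)) = a
          generalize ψ₀ (y (ρ k) * B (ρ k) (ρ i) * c (ρ i)) = b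
          calc c i * (b * a) * y j = c i * b * 1 * a * y j := by simp only [mul_one, mul_assoc]
            _ = _ := by rw [← hyc k]; simp only [mul_assoc]
  · intro A
    ext i j
    simp only [of_apply, hρ i, hρ j]
    have h1 : ∀ b, y (ρ j) * (c (ρ j) * b * y (ρ i)) * c (ρ i) = b := fun b => by
      calc _ = y (ρ j) * c (ρ j) * b * (y (ρ i) * c (ρ i)) := by simp only [mul_assoc]
        _ = b := by rw [hyc, hyc, one_mul, mul_one]
    rw [h1, hψ.involutive]
    calc _ = c i * y i * A i j * (c j * y j) := by simp only [mul_assoc]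
      _ = _ := by rw [hcy, hcy, one_mul, mul_one]
  · intro g Y hY i j
    have h1 := h.mul_mem (h.mul_mem (hy (ρ j)) (apply_mem_of_mem_matrixGrading hY (ρ j) (ρ i)))
      (hc (ρ i))
    have h2 := h.mul_mem (h.mul_mem (hc i) (hψ.map_mem h1)) (hy j)
    rw [of_apply]
    convert h2 using 2
    rw [← hρδ i, ← hρδ j]
    group

end IsGradedDivisionAlgebra

theorem hyperbolicForm_eq_orthogonalForm {m k : ℕ} {x y : D} (hxy : 0 < m → x = y)
    {c : F} (hc : algebraMap F D c = y) :
    c • hyperbolicForm (1 : D) (Fin m) (Fin k) = orthogonalForm m k x y := by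
  rcases Nat.eq_zero_or_pos m with rfl | hm
  · ext (i | i | i) (j | j | j) <;> first | exact i.elim0 | exact j.elim0 | skip
    all_goals simp [hyperbolicForm, orthogonalForm, ← hc, diagonal_apply, one_apply,
      Algebra.algebraMap_eq_smul_one]
  · obtain rfl := hxy hm
    ext (i | i | i) (j | j | j)
    all_goals simp [hyperbolicForm, orthogonalForm, ← hc, diagonal_apply, one_apply,
      Algebra.algebraMap_eq_smul_one]

theorem hyperbolicForm_eq_symplecticForm {k : ℕ} {y : D} {c : F} (hc : algebraMap F D c = y) :
    c • hyperbolicForm (-1 : D) (Fin 0) (Fin k) = symplecticForm 0 k y := by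
  ext (i | i | i) (j | j | j) <;> first | exact i.elim0 | exact j.elim0 | skip
  all_goals simp [hyperbolicForm, symplecticForm, ← hc, diagonal_apply, one_apply,
      Algebra.algebraMap_eq_smul_one]

theorem SameDegrees.pairedDegrees_one (h : IsGradedDivisionAlgebra 𝒟) {ι : Type*} {γ : ι → G}
    {m k : ℕ} {g₀ : G} {g : Fin m → G} {g' : Fin k → G}
    (hs : SameDegrees 𝒟 γ (pairedDegrees g₀ g g')) (hg₀ : g₀ ∈ gradedSupport 𝒟) :
    SameDegrees 𝒟 γ (pairedDegrees 1 g g') := by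
  refine hs.trans h ⟨.refl _, ?_⟩
  rintro (i | i | i)
  · simpa [pairedDegrees] using h.one_mem_support
  · simpa [pairedDegrees] using h.one_mem_support
  · simpa [pairedDegrees] using h.inv_mem_support hg₀

/-- The monomial form fixes the first m indices and swaps the two halves of each pair. Its degree
condition is g₀ = 1 at a fixed index and g₀² = 1 at a pair. -/
theorem IsAdmissible.exists_involution {ι : Type*} [Fintype ι] [DecidableEq ι]
    (h : IsGradedDivisionAlgebra 𝒟) (e : D ≃ₐ[F] Matrix (Fin l) (Fin l) F) {γ : ι → G} {m k : ℕ}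
    {g₀ : G} {ψ₀ : D → D} {g : Fin m → G} {g' : Fin k → G} (ha : IsAdmissible 𝒟 g₀ ψ₀ m k)
    (hg₀ : 0 < m → g₀ = 1) (hs : SameDegrees 𝒟 γ (pairedDegrees g₀ g g')) :
    ∃ ψ, IsDegreeInvertingInvolution (matrixGrading 𝒟 γ) ψ := by
  obtain ⟨σ, hσ⟩ := hs
  let π : Fin m ⊕ (Fin k ⊕ Fin k) → Fin m ⊕ (Fin k ⊕ Fin k) := Sum.map id Sum.swap
  have hπ : Function.Involutive π := by rintro (i | i | i) <;> rfl
  refine h.exists_matrix_involution e ha.involution hσ (fun i => σ.symm (π (σ i)))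
    (fun i => by simp [hπ (σ i)]) fun i => ?_
  rw [Equiv.apply_symm_apply]
  generalize σ i = j
  rcases j with j | j | j
  · simp [π, hg₀ (Nat.zero_lt_of_lt j.2)]
  · have := ha.sq_eq_one (Nat.zero_lt_of_lt j.2)
    rw [pow_two] at this
    simp [π, pairedDegrees, mul_assoc, this]
  · rfl

theorem exists_canonical_form [IsAlgClosed F] (h : IsGradedDivisionAlgebra 𝒟)
    (e : D ≃ₐ[F] Matrix (Fin l) (Fin l) F) {n : ℕ} (hn : 0 < n) {γ : Fin n → G} {X : G → D}
    (hX : ∀ u ∈ gradedSupport 𝒟, X u ∈ 𝒟 u ∧ X u ≠ 0)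
    {ψ : Matrix (Fin n) (Fin n) D → Matrix (Fin n) (Fin n) D}
    (hψ : IsDegreeInvertingInvolution (matrixGrading 𝒟 γ) ψ) :
    ∃ (g₀ : G) (ψ₀ : D → D) (m k : ℕ) (g : Fin m → G) (g' : Fin k → G),
      IsAdmissible 𝒟 g₀ ψ₀ m k ∧
      (g₀ ∈ gradedSupport 𝒟 → IsDegreeInvertingInvolution 𝒟 ψ₀) ∧
      SameDegrees 𝒟 γ (pairedDegrees g₀ g g') ∧
      ∃ (P : Matrix (Fin n) (Fin m ⊕ (Fin k ⊕ Fin k)) D)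
        (Q : Matrix (Fin m ⊕ (Fin k ⊕ Fin k)) (Fin n) D)
        (Φ : (Matrix (Fin m ⊕ (Fin k ⊕ Fin k)) (Fin m ⊕ (Fin k ⊕ Fin k)) D)ˣ),
        IsHomogeneousBaseChange 𝒟 γ (pairedDegrees g₀ g g') P Q ∧
        (∀ Y : Matrix (Fin n) (Fin n) D,
          Q * ψ Y * P = (Φ⁻¹).val * (Q * Y * P).transpose.map ψ₀ * Φ.val) ∧
        ((Φ.val = orthogonalForm m k (X g₀) (X 1) ∧ Φ.val.transpose.map ψ₀ = Φ.val) ∨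
          (m = 0 ∧ Φ.val = symplecticForm m k (X 1) ∧
            Φ.val.transpose.map ψ₀ = -Φ.val)) := by
  have : FiniteDimensional F D := e.symm.toLinearEquiv.finiteDimensional
  have : Nonempty (Fin n) := ⟨⟨0, hn⟩⟩
  obtain ⟨g₀, ψ₀, ε, Γ, hg₀, hT, hε, hψ₀, hΓ, hadj⟩ := exists_isGradedGramMatrix h e hψ
  obtain ⟨m, k, g, g', hm, hG⟩ := hΓ.hasHyperbolicForm h hψ₀ hε hg₀ hT
  have hH := hΓ.of_gramEquiv h.toIsGroupGrading hψ₀ hε hG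
  obtain ⟨hs, P, Q, hPQ, hP⟩ := hG
  obtain ⟨N, hN1, hN2⟩ := hH.exists_inv
  set H : Matrix (Fin m ⊕ (Fin k ⊕ Fin k)) (Fin m ⊕ (Fin k ⊕ Fin k)) D :=
    hyperbolicForm ε (Fin m) (Fin k) with hHdef
  obtain ⟨hX1, hX0⟩ := hX 1 h.one_mem_support
  -- X 1 is a nonzero scalar c, so Φ can be taken to be cH, which defines the same adjoint as H.
  obtain ⟨c, hc⟩ := h.exists_algebraMap_eq hX1
  have hc0 : c ≠ 0 := by rintro rfl; exact hX0 (by rw [← hc, map_zero])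
  have hHc : ∀ Y, H * (Q * ψ Y * P) = (Q * Y * P)ᵀ.map ψ₀ * H := fun Y => by
    calc H * (Q * ψ Y * P) = Pᵀ.map ψ₀ * (Γ * ((P * Q) * ψ Y)) * P := by
          rw [← hP]; simp only [Matrix.mul_assoc]
      _ = Pᵀ.map ψ₀ * (Yᵀ.map ψ₀ * Γ) * P := by rw [hPQ.mul_inv, Matrix.one_mul, hadj]
      _ = (Y * P)ᵀ.map ψ₀ * (Γ * P) := by
          rw [hψ₀.transpose_map_mul]; simp only [Matrix.mul_assoc]
      _ = (P * (Q * Y * P))ᵀ.map ψ₀ * (Γ * P) := by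
          rw [Matrix.mul_assoc Q, ← Matrix.mul_assoc P, hPQ.mul_inv, Matrix.one_mul]
      _ = _ := by rw [hψ₀.transpose_map_mul P, ← hP]; simp only [Matrix.mul_assoc]
  have hΦsymm : (c • H)ᵀ.map ψ₀ = ε • (c • H) := by
    rw [smul_comm, ← hH.symm]
    ext i j
    simp only [map_apply, transpose_apply, Matrix.smul_apply, hψ₀.map_smul]
  refine ⟨g₀, ψ₀, m, k, g, g', ⟨hψ₀, fun hg => ?_, fun _ => by rw [pow_two, hg₀]⟩, fun hg => ?_, hs,
    P, Q, ⟨c • H, c⁻¹ • N, ?_, ?_⟩, hPQ, fun Y => ?_, ?_⟩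
  · by_contra hm0
    exact hg ((hm (Nat.pos_of_ne_zero hm0)).1 ▸ h.one_mem_support)
  · refine { hψ₀ with map_mem := fun {t d} hd => ?_ }
    simpa [hT hg] using hψ₀.map_mem hd
  · rw [smul_mul_smul_comm, mul_inv_cancel₀ hc0, hN1, one_smul]
  · rw [smul_mul_smul_comm, inv_mul_cancel₀ hc0, hN2, one_smul]
  · change Q * ψ Y * P = c⁻¹ • N * (Q * Y * P)ᵀ.map ψ₀ * c • H
    rw [Matrix.mul_assoc (c⁻¹ • N), Matrix.mul_smul, ← hHc, smul_mul_smul_comm,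
      inv_mul_cancel₀ hc0, one_smul, ← Matrix.mul_assoc, hN2, Matrix.one_mul]
  · change (c • H = _ ∧ (c • H)ᵀ.map ψ₀ = c • H) ∨
      (m = 0 ∧ c • H = _ ∧ (c • H)ᵀ.map ψ₀ = -(c • H))
    rw [hΦsymm, hHdef]
    by_cases hε1 : ε = 1
    · subst hε1
      exact .inl ⟨hyperbolicForm_eq_orthogonalForm (fun h0 => by rw [(hm h0).1]) hc, one_smul _ _⟩
    · obtain rfl := hε.resolve_left hε1
      have hm0 : m = 0 := by
        by_contra hm0
        exact hε1 (hm (Nat.pos_of_ne_zero hm0)).2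
      subst hm0
      exact .inr ⟨rfl, hyperbolicForm_eq_symplecticForm hc, neg_one_smul _ _⟩

end Involutions

theorem mainTheorem2 {F G D : Type*} [Field F] [IsAlgClosed F] [Group G] [Ring D] [Algebra F D]
    (𝒟 : G → Submodule F D) (h𝒟 : IsGradedDivisionAlgebra 𝒟)
    (hD : ∃ l : ℕ, Nonempty (D ≃ₐ[F] Matrix (Fin l) (Fin l) F))
    (n : ℕ) (hn : 0 < n) (γ : Fin n → G) :
    -- the criterion
    ((∃ ψ : Matrix (Fin n) (Fin n) D → Matrix (Fin n) (Fin n) D,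
        IsDegreeInvertingInvolution (matrixGrading 𝒟 γ) ψ) ↔
      ∃ (g₀ : G) (ψ₀ : D → D) (m k : ℕ) (g : Fin m → G) (g' : Fin k → G),
        IsAdmissible 𝒟 g₀ ψ₀ m k ∧ SameDegrees 𝒟 γ (pairedDegrees g₀ g g')) ∧
    -- if `g₀ ∈ T`, the involution of `D` can be taken degree-inverting, with `g₀` replaced by `1`
    (∀ (g₀ : G) (ψ₀ : D → D) (m k : ℕ) (g : Fin m → G) (g' : Fin k → G),
      IsAdmissible 𝒟 g₀ ψ₀ m k → SameDegrees 𝒟 γ (pairedDegrees g₀ g g') →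
      g₀ ∈ gradedSupport 𝒟 →
      ∃ ψ₁ : D → D, IsDegreeInvertingInvolution 𝒟 ψ₁ ∧ IsAdmissible 𝒟 1 ψ₁ m k ∧
        SameDegrees 𝒟 γ (pairedDegrees 1 g g')) ∧
    -- the explicit form of every degree-inverting involution
    (∀ X : G → D, (∀ u ∈ gradedSupport 𝒟, X u ∈ 𝒟 u ∧ X u ≠ 0) →
      ∀ ψ : Matrix (Fin n) (Fin n) D → Matrix (Fin n) (Fin n) D,
        IsDegreeInvertingInvolution (matrixGrading 𝒟 γ) ψ →
      ∃ (g₀ : G) (ψ₀ : D → D) (m k : ℕ) (g : Fin m → G) (g' : Fin k → G),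
        IsAdmissible 𝒟 g₀ ψ₀ m k ∧
        (g₀ ∈ gradedSupport 𝒟 → IsDegreeInvertingInvolution 𝒟 ψ₀) ∧
        SameDegrees 𝒟 γ (pairedDegrees g₀ g g') ∧
        ∃ (P : Matrix (Fin n) (Fin m ⊕ (Fin k ⊕ Fin k)) D)
          (Q : Matrix (Fin m ⊕ (Fin k ⊕ Fin k)) (Fin n) D)
          (Φ : (Matrix (Fin m ⊕ (Fin k ⊕ Fin k)) (Fin m ⊕ (Fin k ⊕ Fin k)) D)ˣ),
          IsHomogeneousBaseChange 𝒟 γ (pairedDegrees g₀ g g') P Q ∧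
          (∀ Y : Matrix (Fin n) (Fin n) D,
            Q * ψ Y * P = (Φ⁻¹).val * (Q * Y * P).transpose.map ψ₀ * Φ.val) ∧
          -- orthogonal: the form with matrix `Φ` is `ψ₀`-hermitian
          ((Φ.val = orthogonalForm m k (X g₀) (X 1) ∧
              Φ.val.transpose.map ψ₀ = Φ.val) ∨
          -- symplectic: the form with matrix `Φ` is skew-`ψ₀`-hermitian
            (m = 0 ∧ Φ.val = symplecticForm m k (X 1) ∧
              Φ.val.transpose.map ψ₀ = -Φ.val))) := by
  obtain ⟨l, ⟨e⟩⟩ := hD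
  have part2 : ∀ (g₀ : G) (ψ₀ : D → D) (m k : ℕ) (g : Fin m → G) (g' : Fin k → G),
      IsAdmissible 𝒟 g₀ ψ₀ m k → SameDegrees 𝒟 γ (pairedDegrees g₀ g g') →
      g₀ ∈ gradedSupport 𝒟 →
      ∃ ψ₁ : D → D, IsDegreeInvertingInvolution 𝒟 ψ₁ ∧ IsAdmissible 𝒟 1 ψ₁ m k ∧
        SameDegrees 𝒟 γ (pairedDegrees 1 g g') := by
    intro g₀ ψ₀ m k g g' ha hs hg₀
    obtain ⟨ψ₁, hψ₁⟩ := h𝒟.exists_isDegreeInvertingInvolution e ha.involution hg₀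
    refine ⟨ψ₁, hψ₁, ⟨{ hψ₁ with map_mem := fun {t d} hd => ?_ },
      fun h => absurd h𝒟.one_mem_support h, fun _ => one_pow 2⟩, hs.pairedDegrees_one h𝒟 hg₀⟩
    simpa using hψ₁.map_mem hd
  refine ⟨⟨?_, ?_⟩, part2, fun X hX ψ hψ => exists_canonical_form h𝒟 e hn hX hψ⟩
  · rintro ⟨ψ, hψ⟩
    choose! X hX using fun u (hu : u ∈ gradedSupport 𝒟) => mem_gradedSupport.1 hu
    obtain ⟨g₀, ψ₀, m, k, g, g', ha, -, hs, -⟩ := exists_canonical_form h𝒟 e hn hX hψ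
    exact ⟨g₀, ψ₀, m, k, g, g', ha, hs⟩
  · rintro ⟨g₀, ψ₀, m, k, g, g', ha, hs⟩
    -- Fixed indices require g₀ = 1: inside T this is arranged by the second part, and outside T
    -- admissibility gives m = 0.
    by_cases hg₀ : g₀ ∈ gradedSupport 𝒟
    · obtain ⟨ψ₁, -, ha₁, hs₁⟩ := part2 g₀ ψ₀ m k g g' ha hs hg₀
      exact ha₁.exists_involution h𝒟 e (fun _ => rfl) hs₁
    · exact ha.exists_involution h𝒟 e (fun hm => absurd (ha.eq_zero hg₀) hm.ne') hs
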